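/- **Setting.** Let $S=\{p_1,\dots,p_{\ell-1},\infty\}$, where $p_1,\dots,p_{\ell-1}$ ($\ell\ge 1$) are distinct primes. Put $\mathbb Q_S=\prod_{v\in S}\mathbb Q_v$ (with $\mathbb Q_\infty=\mathbb R$) and $\mathbb Z_S=\mathbb Z[1/p_1,\dots,1/p_{\ell-1}]$, embedded diagonally in $\mathbb Q_S$. For $\mathbf x=(\mathbf x^{(v)})_{v\in S}\in\mathbb Q_S^m$ let $c(\mathbf x)=\prod_{v\in S}\|\mathbf x^{(v)}\|_v$, where $\|\cdot\|_\infty$ is the Euclidean norm on $\mathbb R^m$ and $\|\cdot\|_p$ is the sup-norm on $\mathbb Q_p^m$ (with $|p|_p=1/p$). For a lattice $\Lambda=g\mathbb Z_S^m$, $g\in GL(m,\mathbb Q_S)$, put $\delta(\Lambda)=\min\{c(\mathbf x): \mathbf x\in\Lambda\smallsetminus\{0\}\}$. The rank of a $\mathbb Z_S$-submodule of $\mathbb Q_S^m$ is the dimension of its $\mathbb Q$-span. A submodule $\Delta$ of $\mathbb Z_S^m$ is *primitive* if every submodule of $\mathbb Z_S^m$ that contains $\Delta$ and has the same rank equals $\Delta$;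 $\mathfrak P(\mathbb Z_S,m)$ is the set of nonzero primitive submodules of $\mathbb Z_S^m$. For $\Delta\in\mathfrak P(\mathbb Z_S,m)$ and $g\in GL(m,\mathbb Q_S)$, $\operatorname{cov}(g\Delta)$ is the covolume of $g\Delta$ in $L=\mathbb Q_S\,g\Delta$ with respect to the following volume on $L$. Let $\lambda_S$ be the product of Lebesgue measure on $\mathbb R$ and of the Haar measures on the $\mathbb Q_p$, $p\in S$, that give $\mathbb Z_p$ measure $1$. Choose a basis $\mathbf b_1,\dots,\mathbf b_r$ of $L=\prod_{v\in S} L_v$ over $\mathbb Q_S$ such that the $\mathbf b_i^{(\infty)}$ form an orthonormal basis of $L_\infty$ and, for every prime $p\in S$, $L_p\cap\mathbb Z_p^m=\sum_i\mathbb Z_p\mathbf b_i^{(p)}$. The volume on $L$ is the image of the product measure $\lambda_S^r$ on $\mathbb Q_S^r$ under the linear map that sends the standard basis to $\mathbf b_1,\dots,\mathbf b_r$; it does not depend on the choice of the $\mathbf b_i$. In a metric space $X$ let $B(x,r)$ be the open ball with center $x$ and radius $r>0$. $X$ is *Besicovitch* if there is a constant $N$ such that for every bounded $A\subset X$ and every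 family $\mathcal B$ of nonempty open balls for which each point of $A$ is a center of some ball of $\mathcal B$, there is a finite or countable subfamily of $\mathcal B$ that covers $A$ and has multiplicity at most $N$ at every point of $X$; $N_X$ is the least such $N$. A locally finite Borel measure $\mu$ on $X$ is *uniformly Federer* if $$D_\mu=\sup_{x\in\operatorname{supp}\mu,\ r>0}\frac{\mu(B(x,3r))}{\mu(B(x,r))}<\infty .$$ Write $\|f\|_{\mu,B}=\sup_{B\cap\operatorname{supp}\mu}|f|\in[0,\infty]$. For $C,\alpha>0$, a function $f$ is *$(C,\alpha)$-good* on $U\subset X$ with respect to $\mu$ if for every open ball $B\subset U$ centered in $\operatorname{supp}\mu$ and every $\varepsilon>0$, $$\mu(\{x\in B:|f(x)|<\varepsilon\})\le C\left(\frac{\varepsilon}{\|f\|_{\mu,B}}\right)^{\alpha}\mu(B).$$ **Theorem 8.3.** Let $X$ be a Besicovitch metric space, $\mu$ a uniformly Federer measure on $X$, $S$ as above and $m\ge 1$. Let $B=B(x_0,r_0)$ be a ball in $X$ with $x_0\in\operatorname{supp}\mu$ and $r_0>0$, put $\tilde B=B(x_0,3^m r_0)$, and let $h:\tilde B\to GL(m,\mathbb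 Q_S)$ be continuous. Suppose that for some $C,\alpha>0$ and $0<\rho<1$ one has (i) for every $\Delta\in\mathfrak P(\mathbb Z_S,m)$ the function $x\mapsto\operatorname{cov}(h(x)\Delta)$ is $(C,\alpha)$-good on $\tilde B$ with respect to $\mu$; (ii) for every $\Delta\in\mathfrak P(\mathbb Z_S,m)$, $\ \|\operatorname{cov}(h(\cdot)\Delta)\|_{\mu,B}\ge\rho$. Then for every $\varepsilon$ with $0<\varepsilon\le\rho$, $$\mu\big(\{x\in B:\delta(h(x)\mathbb Z_S^m)<\varepsilon\}\big)\le mC\,(N_XD_\mu^2)^m\left(\frac{\varepsilon}{\rho}\right)^{\alpha}\mu(B).$$ -/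

import Mathlib

open MeasureTheory Set
open scoped ENNReal

noncomputable section

/-! ### Metric spaces and measures -/

/-- The covering property with multiplicity at most `N`: for every bounded `A` and every family
of nonempty open balls such that each point of `A` is a center of some ball of the family, there
is a countable subfamily which covers `A` and has multiplicity at most `N` at every point. -/
def HasCoveringMultiplicity (X : Type*) [MetricSpace X] (N : ℕ) : Prop :=
  ∀ (A : Set X) (F : Set (Set X)), Bornology.IsBounded A →
    (∀ b ∈ F, ∃ x : X, ∃ r : ℝ, 0 < r ∧ b = Metric.ball x r) →
    (∀ x ∈ A, ∃ r : ℝ, 0 < r ∧ Metric.ball x r ∈ F) →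
    ∃ G : Set (Set X), G ⊆ F ∧ G.Countable ∧ A ⊆ ⋃₀ G ∧ ∀ y : X, {b ∈ G | y ∈ b}.encard ≤ N

/-- Besicovitch metric spaces. -/
def IsBesicovitch (X : Type*) [MetricSpace X] : Prop :=
  ∃ N : ℕ, HasCoveringMultiplicity X N

/-- The constant `N_X`: the least multiplicity that works (used for Besicovitch spaces only, where
the infimum is attained). -/
def besicovitchConst (X : Type*) [MetricSpace X] : ℕ :=
  sInf {N : ℕ | HasCoveringMultiplicity X N}

/-- `D_μ(c)`, the supremum of `μ (B (x, c r)) / μ (B (x, r))` over `x ∈ supp μ` and `r > 0`. -/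
def federerConst {X : Type*} [MetricSpace X] [MeasurableSpace X] (μ : Measure X) (c : ℝ) : ℝ≥0∞ :=
  ⨆ x ∈ μ.support, ⨆ (r : ℝ) (_ : 0 < r), μ (Metric.ball x (c * r)) / μ (Metric.ball x r)

/-- Uniformly Federer measures: locally finite, with `D_μ(3)` finite. -/
structure IsUniformlyFederer {X : Type*} [MetricSpace X] [MeasurableSpace X] (μ : Measure X) :
    Prop where
  locallyFinite : IsLocallyFiniteMeasure μ
  doubling : federerConst μ 3 < ∞

/-- `‖f‖_{μ,B}`, the supremum of `|f|` on `B ∩ supp μ`, with values in `[0, ∞]`. -/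
def supNormOn {X F : Type*} [MetricSpace X] [MeasurableSpace X] [NormedField F]
    (μ : Measure X) (f : X → F) (B : Set X) : ℝ≥0∞ :=
  ⨆ x ∈ B ∩ μ.support, ‖f x‖ₑ

/-- `f` is `(C, α)`-good on `U` with respect to `μ`. Only the values of `f` on `U` matter. The
quotient is taken in `[0, ∞]`; it is infinite if the supremum in the denominator vanishes. -/
def IsGood {X F : Type*} [MetricSpace X] [MeasurableSpace X] [NormedField F]
    (C α : ℝ) (μ : Measure X) (f : X → F) (U : Set X) : Prop :=
  ∀ (x : X) (r : ℝ), x ∈ μ.support → 0 < r → Metric.ball x r ⊆ U →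
    ∀ ε : ℝ, 0 < ε →
      μ {y ∈ Metric.ball x r | ‖f y‖ < ε} ≤
        ENNReal.ofReal C * (ENNReal.ofReal ε / supNormOn μ f (Metric.ball x r)) ^ α *
          μ (Metric.ball x r)

/-! ### The rings `ℤ_S` and `ℚ_S`

The set `S` consists of the Archimedean valuation and of the `p`-adic ones for `p ∈ S`. -/

instance natPrimesFact (p : Nat.Primes) : Fact (p : ℕ).Prime := ⟨p.2⟩

/-- `ℚ_S`, the product of the completions of `ℚ` at the places of `S`. -/
abbrev QS (S : Finset Nat.Primes) : Type := ℝ × ((p : S) → ℚ_[(p : Nat.Primes)])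

/-- `ℤ_S`: the rational numbers which are `q`-integral for all primes `q ∉ S`. -/
def ZS (S : Finset Nat.Primes) : Subring ℚ where
  carrier := {x | ∀ q : Nat.Primes, q ∉ S → ‖(x : ℚ_[q])‖ ≤ 1}
  zero_mem' := fun q _ => by simp
  one_mem' := fun q _ => by simp
  add_mem' := fun {a b} ha hb q hq => by
    rw [Rat.cast_add]
    exact (Padic.nonarchimedean _ _).trans (max_le (ha q hq) (hb q hq))
  mul_mem' := fun {a b} ha hb q hq => by
    rw [Rat.cast_mul, norm_mul]
    exact mul_le_one₀ (ha q hq) (norm_nonneg _) (hb q hq)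
  neg_mem' := fun {a} ha q hq => by
    rw [Rat.cast_neg, norm_neg]
    exact ha q hq

/-- The real component of a vector of `ℚ_S ^ m`, as a vector of Euclidean space. -/
def archPart {S : Finset Nat.Primes} {m : ℕ} (x : Fin m → QS S) : EuclideanSpace ℝ (Fin m) :=
  WithLp.toLp 2 (fun i => (x i).1)

/-- The `p`-adic component of a vector of `ℚ_S ^ m`. -/
def padicPart {S : Finset Nat.Primes} {m : ℕ} (p : S) (x : Fin m → QS S) :
    Fin m → ℚ_[(p : Nat.Primes)] :=
  fun i => (x i).2 p

/-- The content of a vector of `ℚ_S ^ m`: the product of the Euclidean norm of the real component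
and of the sup-norms of the `p`-adic components. -/
def content {S : Finset Nat.Primes} {m : ℕ} (x : Fin m → QS S) : ℝ :=
  ‖archPart x‖ * ∏ p : S, ‖padicPart p x‖

/-! ### Submodules -/

/-- The lattice `ℤ_S ^ m` in `ℚ_S ^ m` (diagonal embedding). -/
def stdLattice (S : Finset Nat.Primes) (m : ℕ) : Submodule (ZS S) (Fin m → QS S) :=
  LinearMap.range ((Algebra.linearMap (ZS S) (QS S)).compLeft (Fin m))

/-- The rank of a `ℤ_S`-submodule: the dimension over `ℚ` of its `ℚ`-span. -/
def rk {S : Finset Nat.Primes} {m : ℕ} (Δ : Submodule (ZS S) (Fin m → QS S)) : Cardinal :=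
  Module.rank ℚ (Submodule.span ℚ (Δ : Set (Fin m → QS S)))

/-- `Δ` is a primitive submodule of `Λ`: a submodule of `Λ` that contains `Δ` and has the same rank
is equal to `Δ`. -/
def IsPrimitiveIn {S : Finset Nat.Primes} {m : ℕ} (Δ Λ : Submodule (ZS S) (Fin m → QS S)) : Prop :=
  Δ ≤ Λ ∧ ∀ Δ' : Submodule (ZS S) (Fin m → QS S), Δ' ≤ Λ → Δ ≤ Δ' → rk Δ' = rk Δ → Δ' = Δ

/-- The image `g Δ` of a `ℤ_S`-submodule under `g ∈ GL(m, ℚ_S)`. -/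
def glMap {S : Finset Nat.Primes} {m : ℕ} (g : Matrix.GeneralLinearGroup (Fin m) (QS S))
    (Δ : Submodule (ZS S) (Fin m → QS S)) : Submodule (ZS S) (Fin m → QS S) :=
  Δ.map ((Matrix.mulVecLin (g : Matrix (Fin m) (Fin m) (QS S))).restrictScalars (ZS S))

/-- `δ(Λ)`, the minimum of the content over the nonzero vectors of `Λ`. -/
def delta {S : Finset Nat.Primes} {m : ℕ} (Λ : Submodule (ZS S) (Fin m → QS S)) : ℝ :=
  sInf (content '' {x | x ∈ Λ ∧ x ≠ 0})

/-! ### Haar measures and covolumes -/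

instance padicMeasurableSpace (p : ℕ) [Fact p.Prime] : MeasurableSpace ℚ_[p] := borel _

instance padicBorelSpace (p : ℕ) [Fact p.Prime] : BorelSpace ℚ_[p] := ⟨rfl⟩

/-- `ℤ_p` as a compact subset of `ℚ_p` with nonempty interior. -/
def padicUnitBall (p : ℕ) [Fact p.Prime] : TopologicalSpace.PositiveCompacts ℚ_[p] where
  carrier := Metric.closedBall 0 1
  isCompact' := isCompact_closedBall 0 1
  interior_nonempty' :=
    ⟨0, Metric.ball_subset_interior_closedBall (Metric.mem_ball_self one_pos)⟩

/-- The Haar measure on `ℚ_p` that gives `ℤ_p` measure `1`. -/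
def padicHaar (p : ℕ) [Fact p.Prime] : Measure ℚ_[p] := Measure.addHaarMeasure (padicUnitBall p)

/-- The normalized Haar measure `λ_S` on `ℚ_S`. -/
def haarQS (S : Finset Nat.Primes) : Measure (QS S) :=
  (volume : Measure ℝ).prod (Measure.pi fun p : S => padicHaar (p : Nat.Primes))

/-- A basis `b₁, …, b_r` of a `ℚ_S`-submodule `L` of `ℚ_S ^ m` is adapted if its real component is
orthonormal and its `p`-adic component generates the `ℤ_p`-module `L_p ∩ ℤ_p ^ m`, for `p ∈ S`. -/
structure IsAdapted {S : Finset Nat.Primes} {m r : ℕ} {L : Submodule (QS S) (Fin m → QS S)}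
    (b : Module.Basis (Fin r) (QS S) L) : Prop where
  orthonormal : Orthonormal ℝ fun i => archPart (b i : Fin m → QS S)
  integral : ∀ p : S,
    padicPart p '' (L : Set (Fin m → QS S)) ∩ {y | ∀ j, ‖y j‖ ≤ 1} =
      (Submodule.span ℤ_[(p : Nat.Primes)]
        (range fun i => padicPart p (b i : Fin m → QS S)) :
          Set (Fin m → ℚ_[(p : Nat.Primes)]))

open Classical in
/-- The normalized volume on a free `ℚ_S`-submodule `L` of `ℚ_S ^ m`: the image of the product
measure on `ℚ_S ^ r` under the linear map that takes the standard basis to an adapted basis of `L`.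
(It does not depend on the adapted basis; the value for other `L` is irrelevant.) -/
def volumeOn {S : Finset Nat.Primes} {m : ℕ} (L : Submodule (QS S) (Fin m → QS S)) : Measure L :=
  if H : ∃ b : (Σ r : ℕ, Module.Basis (Fin r) (QS S) L), IsAdapted b.2 then
    (Measure.pi fun _ : Fin H.choose.1 => haarQS S).map fun c => ∑ i, c i • H.choose.2 i
  else 0

/-- The covolume of a `ℤ_S`-submodule `Δ` of `ℚ_S ^ m` in `L = ℚ_S Δ`: the normalized volume of
a fundamental domain for the action of `Δ` on `L` by translations. -/
def cov {S : Finset Nat.Primes} {m : ℕ} (Δ : Submodule (ZS S) (Fin m → QS S)) : ℝ :=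
  (addCovolume
    (Δ.toAddSubgroup.comap
      (Submodule.span (QS S) (Δ : Set (Fin m → QS S))).subtype.toAddMonoidHom)
    (Submodule.span (QS S) (Δ : Set (Fin m → QS S)))
    (volumeOn (Submodule.span (QS S) (Δ : Set (Fin m → QS S))))).toReal

end

/-!
The function `δ` is bounded below by a combinatorial argument about flags of sublattices, and the
exceptional set is estimated by a covering argument that only sees the poset of these sublattices.

*Marked points.* Let `P` be the poset of nonzero primitive submodules of `ℤ_S ^ m`; its chains have
at most `m` elements, because ranks increase strictly. A point `x` is *marked* if there is a chain
`F` in `P` with `ε ≤ cov (h(x) Δ) ≤ ρ` for `Δ ∈ F`, while `cov (h(x) Δ) ≥ ρ` for all other `Δ` that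
are comparable to the whole of `F`. At a marked point every nonzero lattice vector has content at
least `ε` (`le_content_of_isMarked`): for a nonzero vector `u` let `Δ` be the largest member of `F`
that does not contain `u` (or `0`), and `Δ'` the primitive submodule spanned by `Δ` and `u`. Then `Δ'` is
comparable to all members of `F`, and
`ε ≤ cov (h(x) Δ') ≤ cov (h(x) Δ) · c(h(x) u) ≤ c(h(x) u)`.

*Covering.* The points of a ball that are not marked form a small set
(`measure_not_isMarked_le`), by induction on the length of the chains. Around a point `y` that is
not marked, a nearly maximal radius is chosen for which some `cov (h(·) Δ)` stays below `ρ`; on a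
ball of comparable radius all these functions reach `ρ`. A point of the small ball that is not
marked either has `cov (h(·) Δ) < ε`, which is controlled because this function is good, or is not
marked for the poset of the elements comparable to `Δ`, which has shorter chains. The Besicovitch
and Federer properties add up the local estimates. As the radius is chosen only nearly maximal, it
is not needed that finitely many `Δ` have `cov (h(y) Δ) < ρ`; upper semicontinuity of the covolume is
enough.

*Covolumes.* The translates of `[0, 1) × ∏ ℤ_p` by `ℤ_S` tile `ℚ_S`
(`existsUnique_add_mem_unitCell`), so a lattice with basis `w` has as its covolume the normalized
volume of the cell spanned by `w`, and that is the factor by which the matrix of `w` in an adapted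
basis scales the Haar measure of `ℚ_S ^ r`. No determinants over `ℚ_p` are needed: all that is used
about this factor is that it is multiplicative and that it satisfies Hadamard's inequality
(`linScale_le_prod_content`, `cellVol_le_prod_content`): it is at most the product of the contents
of the columns. Once the columns are normalized, this holds because a `p`-adic matrix with integral
entries maps `ℤ_p ^ r` to itself, and by the real Hadamard inequality at the infinite place.
Applied to an adapted basis of `Δ` together with `u`, it gives the submultiplicativity of the
covolume (`cov_glMap_saturation_le`); applied to the images of an adapted basis under `k` close to
`1`, it gives upper semicontinuity (`upperSemicontinuousAt_cov_glMap`).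
-/

noncomputable section

/-! ### Marked points and the covering argument -/

/-- A point `x` is marked, with respect to a family `ψ` of functions indexed by the elements of
`P`, if there is a chain `F` in `P` on which the values `ψ s x` lie between `ε` and `ρ`, while all
other elements of `P` that are comparable to the whole of `F` have values at least `ρ`. -/
def IsMarked {X ι : Type*} [PartialOrder ι] (P : Set ι) (ψ : ι → X → ℝ) (ε ρ : ℝ) (x : X) : Prop :=
  ∃ F : Set ι, F ⊆ P ∧ IsChain (· ≤ ·) F ∧ (∀ s ∈ F, ε ≤ ψ s x ∧ ψ s x ≤ ρ) ∧
    ∀ s ∈ P, s ∉ F → (∀ t ∈ F, s ≤ t ∨ t ≤ s) → ρ ≤ ψ s x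

/-- The elements of `P` that are comparable to `s` and different from `s`. -/
def comparableTo {ι : Type*} [PartialOrder ι] (P : Set ι) (s : ι) : Set ι :=
  {t | t ∈ P ∧ t ≠ s ∧ (t ≤ s ∨ s ≤ t)}

section Marked

variable {X ι : Type*} [PartialOrder ι] {P : Set ι} {ψ : ι → X → ℝ} {ε ρ : ℝ} {x : X}

theorem IsMarked.of_comparableTo {s : ι} (hs : s ∈ P) (h : IsMarked (comparableTo P s) ψ ε ρ x)
    (h1 : ε ≤ ψ s x) (h2 : ψ s x ≤ ρ) : IsMarked P ψ ε ρ x := by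
  obtain ⟨F, hFP, hF, hFψ, hmax⟩ := h
  refine ⟨insert s F, ?_, ?_, ?_, ?_⟩
  · exact insert_subset hs fun t ht => (hFP ht).1
  · exact hF.insert fun t ht _ => (hFP ht).2.2.symm
  · rintro t (rfl | ht)
    exacts [⟨h1, h2⟩, hFψ t ht]
  · intro t ht htF hcomp
    refine hmax t ⟨ht, fun h => htF (h ▸ mem_insert _ _), hcomp s (mem_insert _ _)⟩
      (fun h => htF (mem_insert_of_mem _ h)) fun u hu => hcomp u (mem_insert_of_mem _ hu)

theorem exists_lt_of_not_isMarked (h : ¬ IsMarked P ψ ε ρ x) : ∃ s ∈ P, ψ s x < ρ := by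
  by_contra! H
  exact h ⟨∅, empty_subset _, by simp, by simp, fun s hs _ _ => H s hs⟩

theorem card_chain_comparableTo_le {m : ℕ} {s : ι} (hs : s ∈ P)
    (hP : ∀ F : Finset ι, (F : Set ι) ⊆ P → IsChain (· ≤ ·) (F : Set ι) → F.card ≤ m + 1)
    (F : Finset ι) (hF : (F : Set ι) ⊆ comparableTo P s) (hc : IsChain (· ≤ ·) (F : Set ι)) :
    F.card ≤ m := by
  classical
  have hsF : s ∉ F := fun h => (hF (Finset.mem_coe.2 h)).2.1 rfl
  have := hP (insert s F) (by
    rw [Finset.coe_insert]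
    exact insert_subset hs fun t ht => (hF ht).1) (by
    rw [Finset.coe_insert]
    exact hc.insert fun t ht _ => (hF ht).2.2.symm)
  rw [Finset.card_insert_of_notMem hsF] at this
  omega

end Marked

section Federer

variable {X : Type*} [MetricSpace X] [MeasurableSpace X]

theorem measure_ball_pos_of_mem_support {μ : Measure X} {x : X} (hx : x ∈ μ.support) {r : ℝ}
    (hr : 0 < r) : 0 < μ (Metric.ball x r) :=
  (Measure.mem_support_iff_forall x).1 hx _ (Metric.ball_mem_nhds x hr)

theorem div_measure_ball_le_federerConst {μ : Measure X} {c : ℝ} {x : X} (hx : x ∈ μ.support)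
    {r : ℝ} (hr : 0 < r) :
    μ (Metric.ball x (c * r)) / μ (Metric.ball x r) ≤ federerConst μ c :=
  (le_iSup₂ (f := fun (r : ℝ) (_ : 0 < r) => μ (Metric.ball x (c * r)) / μ (Metric.ball x r))
    r hr).trans (le_iSup₂ (f := fun (x : X) (_ : x ∈ μ.support) => ⨆ (r : ℝ) (_ : 0 < r),
      μ (Metric.ball x (c * r)) / μ (Metric.ball x r)) x hx)

theorem IsUniformlyFederer.measure_ball_lt_top {μ : Measure X} (hμ : IsUniformlyFederer μ) {x : X}
    (hx : x ∈ μ.support) (r : ℝ) : μ (Metric.ball x r) < ∞ := by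
  have := hμ.locallyFinite
  obtain ⟨U, hU, hUfin⟩ := μ.finiteAt_nhds x
  obtain ⟨δ, hδ, hball⟩ := Metric.mem_nhds_iff.1 hU
  -- A quotient with infinite numerator and finite denominator is infinite, so finiteness passes
  -- from each ball to the ball of three times its radius.
  have key : ∀ n : ℕ, μ (Metric.ball x (3 ^ n * δ)) < ∞ := by
    intro n
    induction n with
    | zero => simpa using (measure_mono hball).trans_lt hUfin
    | succ n ih =>
      have hpos : (0 : ℝ) < 3 ^ n * δ := by positivity
      have h1 : μ (Metric.ball x (3 * (3 ^ n * δ))) / μ (Metric.ball x (3 ^ n * δ)) < ∞ :=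
        (div_measure_ball_le_federerConst hx hpos).trans_lt hμ.doubling
      rw [pow_succ', mul_assoc]
      by_contra htop
      rw [not_lt, top_le_iff] at htop
      rw [htop, ENNReal.top_div_of_ne_top ih.ne] at h1
      exact lt_irrefl _ h1
  obtain ⟨n, hn⟩ := pow_unbounded_of_one_lt (r / δ) (by norm_num : (1 : ℝ) < 3)
  refine (measure_mono (Metric.ball_subset_ball ?_)).trans_lt (key n)
  rw [div_lt_iff₀ hδ] at hn
  exact hn.le

theorem IsUniformlyFederer.measure_ball_three_mul_le {μ : Measure X} (hμ : IsUniformlyFederer μ)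
    {x : X} (hx : x ∈ μ.support) {r : ℝ} (hr : 0 < r) :
    μ (Metric.ball x (3 * r)) ≤ federerConst μ 3 * μ (Metric.ball x r) := by
  have h1 : μ (Metric.ball x (3 * r)) / μ (Metric.ball x r) ≤ federerConst μ 3 :=
    div_measure_ball_le_federerConst hx hr
  exact (ENNReal.div_le_iff (measure_ball_pos_of_mem_support hx hr).ne'
    (hμ.measure_ball_lt_top hx r).ne).1 h1

theorem IsUniformlyFederer.one_le_federerConst {μ : Measure X} (hμ : IsUniformlyFederer μ)
    {x : X} (hx : x ∈ μ.support) : 1 ≤ federerConst μ 3 := by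
  have h1 : μ (Metric.ball x (3 * 1)) / μ (Metric.ball x 1) ≤ federerConst μ 3 :=
    div_measure_ball_le_federerConst hx one_pos
  refine le_trans ?_ h1
  rw [ENNReal.le_div_iff_mul_le (Or.inl (measure_ball_pos_of_mem_support hx one_pos).ne')
    (Or.inl (hμ.measure_ball_lt_top hx 1).ne), one_mul]
  exact measure_mono (Metric.ball_subset_ball (by norm_num))

end Federer

section Besicovitch

variable {X : Type*} [MetricSpace X]

theorem HasCoveringMultiplicity.one_le {N : ℕ} (h : HasCoveringMultiplicity X N) (x : X) :
    1 ≤ N := by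
  obtain ⟨G, -, -, hcov, hmult⟩ := h {x} {Metric.ball x 1} (Bornology.isBounded_singleton)
    (by rintro b rfl; exact ⟨x, 1, one_pos, rfl⟩) (by rintro y rfl; exact ⟨1, one_pos, rfl⟩)
  obtain ⟨b, hb, hxb⟩ := hcov rfl
  have h1 : 1 ≤ {b ∈ G | x ∈ b}.encard := by
    rw [Set.one_le_encard_iff_nonempty]
    exact ⟨b, hb, hxb⟩
  exact_mod_cast h1.trans (hmult x)

theorem HasCoveringMultiplicity.separableSpace {N : ℕ} (h : HasCoveringMultiplicity X N) :
    TopologicalSpace.SeparableSpace X := by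
  rcases isEmpty_or_nonempty X with hX | ⟨⟨x₀⟩⟩
  · infer_instance
  have : Nonempty X := ⟨x₀⟩
  have key : ∀ n k : ℕ, ∃ T : Set X, T.Countable ∧
      Metric.ball x₀ n ⊆ ⋃ c ∈ T, Metric.ball c (1 / ((k : ℝ) + 1)) := by
    intro n k
    have hk : (0 : ℝ) < 1 / ((k : ℝ) + 1) := by positivity
    obtain ⟨G, hGF, hGc, hcov, -⟩ := h (Metric.ball x₀ n)
      (range fun c : X => Metric.ball c (1 / ((k : ℝ) + 1))) Metric.isBounded_ball
      (by rintro b ⟨c, rfl⟩; exact ⟨c, _, hk, rfl⟩) (fun c _ => ⟨_, hk, c, rfl⟩)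
    choose! c hc using hGF
    refine ⟨c '' G, hGc.image c, fun y hy => ?_⟩
    obtain ⟨b, hb, hyb⟩ := hcov hy
    refine mem_biUnion (mem_image_of_mem c hb) ?_
    have := hc hb
    simp only at this
    rwa [this]
  choose T hTc hT using key
  refine ⟨⋃ n, ⋃ k, T n k, countable_iUnion fun n => countable_iUnion fun k => hTc n k, ?_⟩
  intro y
  rw [Metric.mem_closure_iff]
  intro δ hδ
  obtain ⟨k, hk⟩ := exists_nat_one_div_lt hδ
  obtain ⟨n, hn⟩ := exists_nat_gt (dist y x₀)
  obtain ⟨c, hc, hyc⟩ := mem_iUnion₂.1 (hT n k (Metric.mem_ball.2 hn))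
  exact ⟨c, mem_iUnion.2 ⟨n, mem_iUnion.2 ⟨k, hc⟩⟩, (Metric.mem_ball.1 hyc).trans hk⟩

/-- For a countable family of measurable sets inside `V` with multiplicity at most `N`, the sum of
the measures is at most `N μ(V)`. -/
theorem tsum_measure_le_of_multiplicity {Y : Type*} [MeasurableSpace Y] (μ : Measure Y)
    {G : Set (Set Y)} (hG : G.Countable) {N : ℕ}
    (hmult : ∀ y : Y, {b ∈ G | y ∈ b}.encard ≤ N) {V : Set Y}
    (hmeas : ∀ b ∈ G, MeasurableSet b) (hV : ∀ b ∈ G, b ⊆ V) :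
    ∑' b : G, μ b ≤ N * μ V := by
  have := hG.to_subtype
  have h1 : ∑' b : G, μ b = ∫⁻ y, ∑' b : G, indicator (b : Set Y) 1 y ∂μ := by
    rw [lintegral_tsum (f := fun (b : G) y => indicator (b : Set Y) 1 y)
      fun b => (measurable_one.indicator (hmeas b b.2)).aemeasurable]
    exact tsum_congr fun b => (lintegral_indicator_one (hmeas b b.2)).symm
  rw [h1]
  refine (lintegral_mono (g := V.indicator fun _ => (N : ℝ≥0∞)) fun y => ?_).trans
    (lintegral_indicator_const_le _ _)
  by_cases hy : y ∈ V
  · have h2 : ∑' b : G, indicator (b : Set Y) (1 : Y → ℝ≥0∞) y =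
        ∑' _ : {b ∈ G | y ∈ b}, (1 : ℝ≥0∞) := by
      rw [tsum_subtype G fun b : Set Y => indicator b (1 : Y → ℝ≥0∞) y,
        tsum_subtype {b ∈ G | y ∈ b} fun _ => (1 : ℝ≥0∞)]
      refine tsum_congr fun b => ?_
      by_cases hb : b ∈ G <;> by_cases hyb : y ∈ b <;> simp [hb, hyb]
    rw [indicator_of_mem hy, h2, ENNReal.tsum_set_one]
    simpa using ENat.toENNReal_le.2 (hmult y)
  · rw [indicator_of_notMem hy]
    refine le_of_eq (ENNReal.tsum_eq_zero.2 fun b => ?_)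
    exact indicator_of_notMem (fun h => hy (hV b b.2 h)) _

end Besicovitch

section Covering

variable {X ι : Type*} [MetricSpace X] [MeasurableSpace X] [PartialOrder ι]

theorem supNormOn_mono {μ : Measure X} (f : X → ℝ) {A B : Set X} (h : A ⊆ B) :
    supNormOn μ f A ≤ supNormOn μ f B :=
  biSup_mono fun _ hx => ⟨h hx.1, hx.2⟩

theorem enorm_le_supNormOn {μ : Measure X} (f : X → ℝ) {A : Set X} {x : X} (hx : x ∈ A)
    (hxμ : x ∈ μ.support) : ‖f x‖ₑ ≤ supNormOn μ f A :=
  le_iSup₂ (f := fun (x : X) (_ : x ∈ A ∩ μ.support) => ‖f x‖ₑ) x ⟨hx, hxμ⟩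

/-- The estimate for a good function, with a lower bound `ρ` in place of the supremum. -/
theorem IsGood.measure_lt_le {C α : ℝ} (hα : 0 < α) {μ : Measure X} {f : X → ℝ} {U : Set X}
    (hf : IsGood C α μ f U) {x : X} {r ρ ε : ℝ} (hx : x ∈ μ.support) (hr : 0 < r)
    (hU : Metric.ball x r ⊆ U) (hε : 0 < ε)
    (hsup : ENNReal.ofReal ρ ≤ supNormOn μ f (Metric.ball x r)) :
    μ {y ∈ Metric.ball x r | ‖f y‖ < ε} ≤
      ENNReal.ofReal C * (ENNReal.ofReal ε / ENNReal.ofReal ρ) ^ α * μ (Metric.ball x r) := by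
  refine (hf x r hx hr hU ε hε).trans ?_
  gcongr

/-- If one of the functions `ψ s` is smaller than `ρ` at `y`, there are a member `s` and a radius
`t` such that `ψ s` stays below `ρ` on the ball of radius `t`, while on a ball with a comparable
radius `r'` none of the functions does. -/
theorem exists_radii {X ι : Type*} [MetricSpace X] [MeasurableSpace X] {μ : Measure X}
    {P : Set ι} {ψ : ι → X → ℝ} (hψ : ∀ s x, 0 ≤ ψ s x)
    {ρ : ℝ} (hρ : 0 < ρ) {x y : X} {r : ℝ} (hy : y ∈ Metric.ball x r)
    (husc : ∀ s ∈ P, UpperSemicontinuousAt (ψ s) y)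
    (hsup : ∀ s ∈ P, ENNReal.ofReal ρ ≤ supNormOn μ (ψ s) (Metric.ball x r))
    (hlt : ∃ s ∈ P, ψ s y < ρ) :
    ∃ s ∈ P, ∃ t r' : ℝ, 0 < t ∧ t < 2 * r ∧ t ≤ r' ∧ r' ≤ 3 * t ∧ r' ≤ 2 * r ∧
      supNormOn μ (ψ s) (Metric.ball y t) < ENNReal.ofReal ρ ∧
      ∀ s ∈ P, ENNReal.ofReal ρ ≤ supNormOn μ (ψ s) (Metric.ball y r') := by
  set T : Set ℝ := {t | 0 < t ∧ ∃ s ∈ P, supNormOn μ (ψ s) (Metric.ball y t) < ENNReal.ofReal ρ}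
    with hT
  rw [Metric.mem_ball] at hy
  have hbd : ∀ t ∈ T, t ≤ r + dist y x := by
    rintro t ⟨-, s, hs, hlt⟩
    by_contra! h
    refine absurd (hlt.trans_le (hsup s hs)) (not_lt.2 (supNormOn_mono _ ?_))
    exact Metric.ball_subset_ball' (by rw [dist_comm x y]; linarith)
  have hne : T.Nonempty := by
    obtain ⟨s, hs, hlt⟩ := hlt
    obtain ⟨a, ha1, ha2⟩ := exists_between hlt
    obtain ⟨t, ht, hball⟩ := Metric.eventually_nhds_iff_ball.1 (husc s hs a ha1)
    refine ⟨t, ht, s, hs, lt_of_le_of_lt (iSup₂_le fun z hz => ?_)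
      ((ENNReal.ofReal_lt_ofReal_iff hρ).2 ha2)⟩
    rw [Real.enorm_eq_ofReal (hψ s z)]
    exact ENNReal.ofReal_le_ofReal (hball z hz.1).le
  have hbdd : BddAbove T := ⟨_, hbd⟩
  -- The supremum of the radii need not be attained, so a radius `t` above half of it is used.
  have hR : sSup T ≤ r + dist y x := csSup_le hne hbd
  have hRpos : 0 < sSup T := by
    obtain ⟨t, ht⟩ := hne
    exact ht.1.trans_le (le_csSup hbdd ht)
  obtain ⟨t, ht, htR⟩ := exists_lt_of_lt_csSup hne (half_lt_self hRpos)
  have htle := le_csSup hbdd ht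
  obtain ⟨ht0, s, hs, hst⟩ := ht
  refine ⟨s, hs, t, min (2 * r) (3 * t), ht0, by linarith, le_min (by linarith) (by linarith),
    min_le_right _ _, min_le_left _ _, hst, fun s' hs' => ?_⟩
  by_contra! h
  have hlt' : sSup T < min (2 * r) (3 * t) := lt_min (by linarith) (by linarith)
  exact absurd (le_csSup hbdd ⟨hRpos.trans hlt', s', hs', h⟩) (not_le.2 hlt')

/-- The points of the support in a ball that are not marked form a small set. The induction on the
length `m` of the chains replaces `P` by the elements comparable to one member, and the ball by one
of radius at most `2 r` around one of its points; a neighborhood `3 ^ m` times larger leaves room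
for this. -/
theorem measure_not_isMarked_le [BorelSpace X] {N : ℕ} (hX : HasCoveringMultiplicity X N)
    {μ : Measure X} (hμ : IsUniformlyFederer μ) {ψ : ι → X → ℝ} (hψ : ∀ s x, 0 ≤ ψ s x)
    {C α ε ρ : ℝ} (hα : 0 < α) (hε : 0 < ε) (hρ : 0 < ρ) (m : ℕ) :
    ∀ (P : Set ι) (x : X) (r : ℝ), x ∈ μ.support → 0 < r →
      (∀ F : Finset ι, (F : Set ι) ⊆ P → IsChain (· ≤ ·) (F : Set ι) → F.card ≤ m) →
      (∀ s ∈ P, IsGood C α μ (ψ s) (Metric.ball x (3 ^ m * r))) →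
      (∀ s ∈ P, ∀ y ∈ Metric.ball x (3 ^ m * r), UpperSemicontinuousAt (ψ s) y) →
      (∀ s ∈ P, ENNReal.ofReal ρ ≤ supNormOn μ (ψ s) (Metric.ball x r)) →
      μ {y ∈ Metric.ball x r | y ∈ μ.support ∧ ¬ IsMarked P ψ ε ρ y} ≤
        m * (ENNReal.ofReal C * (ENNReal.ofReal ε / ENNReal.ofReal ρ) ^ α) *
          (N * federerConst μ 3 ^ 2) ^ m * μ (Metric.ball x r) := by
  set Q : ℝ≥0∞ := ENNReal.ofReal C * (ENNReal.ofReal ε / ENNReal.ofReal ρ) ^ α with hQ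
  set D : ℝ≥0∞ := federerConst μ 3 with hD
  induction m with
  | zero =>
    intro P x r hx hr hP _ _ _
    have hempty : {y ∈ Metric.ball x r | y ∈ μ.support ∧ ¬ IsMarked P ψ ε ρ y} = ∅ := by
      refine eq_empty_of_forall_notMem fun y hy => ?_
      obtain ⟨s, hs, -⟩ := exists_lt_of_not_isMarked hy.2.2
      have := hP {s} (by simpa using hs) (by simp)
      simp at this
    rw [hempty, measure_empty]
    exact zero_le
  | succ m ih =>
    intro P x r hx hr hP hgood husc hsup
    set A := {y ∈ Metric.ball x r | y ∈ μ.support ∧ ¬ IsMarked P ψ ε ρ y} with hA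
    have h3 : (1 : ℝ) ≤ 3 ^ m := one_le_pow₀ (by norm_num)
    rcases isEmpty_or_nonempty ι with hι | hι
    · have hempty : A = ∅ := by
        refine eq_empty_of_forall_notMem fun y hy => ?_
        obtain ⟨s, -⟩ := exists_lt_of_not_isMarked hy.2.2
        exact hι.elim s
      simp [hempty]
    have hrad : ∀ y : X, ∃ (s : ι) (t r' : ℝ), y ∈ A → s ∈ P ∧ 0 < t ∧ t < 2 * r ∧ t ≤ r' ∧
        r' ≤ 3 * t ∧ r' ≤ 2 * r ∧ supNormOn μ (ψ s) (Metric.ball y t) < ENNReal.ofReal ρ ∧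
        ∀ s ∈ P, ENNReal.ofReal ρ ≤ supNormOn μ (ψ s) (Metric.ball y r') := by
      intro y
      by_cases hy : y ∈ A
      · obtain ⟨s, hs, t, r', h⟩ := exists_radii (μ := μ) (P := P) hψ hρ hy.1
          (fun s hs => husc s hs y (Metric.ball_subset_ball (by rw [pow_succ]; nlinarith) hy.1))
          hsup
          (exists_lt_of_not_isMarked hy.2.2)
        exact ⟨s, t, r', fun _ => ⟨hs, h⟩⟩
      · exact ⟨Classical.arbitrary ι, 0, 0, fun h => absurd h hy⟩
    choose s t r' hstr using hrad
    -- On the ball of radius `t y` a point that is not marked either has a value of `ψ (s y)` below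
    -- `ε` or is not marked for the elements comparable to `s y`.
    have hlocal : ∀ y ∈ A, μ (A ∩ Metric.ball y (t y)) ≤
        (m + 1 : ℕ) * Q * (N * D ^ 2) ^ m * D * μ (Metric.ball y (t y)) := by
      intro y hy
      obtain ⟨hs, ht, ht2, htr, hr3, hr2, hsmall, hbig⟩ := hstr y hy
      have hr' : 0 < r' y := ht.trans_le htr
      have hsub : Metric.ball y (3 ^ m * r' y) ⊆ Metric.ball x (3 ^ (m + 1) * r) := by
        refine Metric.ball_subset_ball' ?_
        have h1 := Metric.mem_ball.1 hy.1
        rw [pow_succ]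
        nlinarith
      have hsub0 : Metric.ball y (r' y) ⊆ Metric.ball x (3 ^ (m + 1) * r) :=
        (Metric.ball_subset_ball (by nlinarith)).trans hsub
      have hcover : A ∩ Metric.ball y (t y) ⊆
          {z ∈ Metric.ball y (r' y) | ‖ψ (s y) z‖ < ε} ∪
          {z ∈ Metric.ball y (r' y) | z ∈ μ.support ∧
            ¬ IsMarked (comparableTo P (s y)) ψ ε ρ z} := by
        rintro z ⟨hzA, hz⟩
        have hz' := Metric.ball_subset_ball htr hz
        by_cases hzε : ‖ψ (s y) z‖ < ε
        · exact Or.inl ⟨hz', hzε⟩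
        · refine Or.inr ⟨hz', hzA.2.1, fun hmark => hzA.2.2 (hmark.of_comparableTo hs ?_ ?_)⟩
          · rwa [not_lt, Real.norm_of_nonneg (hψ _ _)] at hzε
          · have := (enorm_le_supNormOn (ψ (s y)) hz hzA.2.1).trans_lt hsmall
            rw [Real.enorm_eq_ofReal (hψ _ _), ENNReal.ofReal_lt_ofReal_iff hρ] at this
            exact this.le
      have hN : (1 : ℝ≥0∞) ≤ N := by exact_mod_cast hX.one_le x
      have hND : (1 : ℝ≥0∞) ≤ (N * D ^ 2) ^ m :=
        one_le_pow₀ (one_le_mul hN (one_le_pow₀ (hμ.one_le_federerConst hx)))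
      calc μ (A ∩ Metric.ball y (t y))
          ≤ Q * μ (Metric.ball y (r' y)) +
            m * Q * (N * D ^ 2) ^ m * μ (Metric.ball y (r' y)) := by
            refine (measure_mono hcover).trans ((measure_union_le _ _).trans (add_le_add ?_ ?_))
            · exact (hgood _ hs).measure_lt_le hα hy.2.1 hr' hsub0 hε (hbig _ hs)
            · exact ih (comparableTo P (s y)) y (r' y) hy.2.1 hr' (card_chain_comparableTo_le hs hP)
                (fun s' hs' z ρ' hz hρ' hzU => hgood s' hs'.1 z ρ' hz hρ' (hzU.trans hsub))
                (fun s' hs' z hz => husc s' hs'.1 z (hsub hz)) fun s' hs' => hbig s' hs'.1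
        _ ≤ Q * (N * D ^ 2) ^ m * μ (Metric.ball y (r' y)) +
            m * Q * (N * D ^ 2) ^ m * μ (Metric.ball y (r' y)) := by
            gcongr
            exact le_mul_of_one_le_right' hND
        _ = (m + 1 : ℕ) * Q * (N * D ^ 2) ^ m * μ (Metric.ball y (r' y)) := by
            push_cast; ring
        _ ≤ (m + 1 : ℕ) * Q * (N * D ^ 2) ^ m * (D * μ (Metric.ball y (t y))) := by
            gcongr
            exact (measure_mono (Metric.ball_subset_ball hr3)).trans
              (hμ.measure_ball_three_mul_le hy.2.1 ht)
        _ = _ := by ring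
    obtain ⟨G, hGF, hGc, hcov, hmult⟩ := hX A ((fun y => Metric.ball y (t y)) '' A)
      (Metric.isBounded_ball.subset fun y hy => hy.1)
      (by rintro b ⟨y, hy, rfl⟩; exact ⟨y, t y, (hstr y hy).2.1, rfl⟩)
      (fun y hy => ⟨t y, (hstr y hy).2.1, y, hy, rfl⟩)
    have hsum : ∑' b : G, μ b ≤ N * μ (Metric.ball x (3 * r)) := by
      refine tsum_measure_le_of_multiplicity μ hGc hmult ?_ ?_
      · intro b hb
        obtain ⟨y, hy, rfl⟩ := hGF hb
        exact Metric.isOpen_ball.measurableSet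
      · intro b hb
        obtain ⟨y, hy, rfl⟩ := hGF hb
        refine Metric.ball_subset_ball' ?_
        have h1 := Metric.mem_ball.1 hy.1
        have h2 := (hstr y hy).2.2.1
        linarith
    have hGcount := hGc.to_subtype
    calc μ A ≤ μ (⋃ b : G, A ∩ b) := by
          refine measure_mono fun y hy => ?_
          obtain ⟨b, hb, hyb⟩ := hcov hy
          exact mem_iUnion.2 ⟨⟨b, hb⟩, hy, hyb⟩
      _ ≤ ∑' b : G, μ (A ∩ b) := measure_iUnion_le _
      _ ≤ ∑' b : G, (m + 1 : ℕ) * Q * (N * D ^ 2) ^ m * D * μ b := by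
          refine ENNReal.tsum_le_tsum fun b => ?_
          obtain ⟨y, hy, hyb⟩ := hGF b.2
          rw [← hyb]
          exact hlocal y hy
      _ = (m + 1 : ℕ) * Q * (N * D ^ 2) ^ m * D * ∑' b : G, μ b := ENNReal.tsum_mul_left
      _ ≤ (m + 1 : ℕ) * Q * (N * D ^ 2) ^ m * D * (N * (D * μ (Metric.ball x r))) := by
          gcongr
          refine hsum.trans ?_
          gcongr
          exact hμ.measure_ball_three_mul_le hx hr
      _ = (m + 1 : ℕ) * Q * (N * D ^ 2) ^ (m + 1) * μ (Metric.ball x r) := by ring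

theorem HasCoveringMultiplicity.measure_compl_support {N : ℕ} (hX : HasCoveringMultiplicity X N)
    (μ : Measure X) : μ (μ.support)ᶜ = 0 := by
  have := hX.separableSpace
  have := UniformSpace.secondCountable_of_separable X
  exact Measure.measure_compl_support

end Covering

/-! ### Haar measure on `ℚ_S ^ r` and linear maps -/

section

open scoped Pointwise NNReal

section Padic

variable (p : ℕ) [Fact p.Prime]

instance padicHaar_isAddHaarMeasure : (padicHaar p).IsAddHaarMeasure := by
  unfold padicHaar; infer_instance

theorem padicHaar_closedBall_one : padicHaar p (Metric.closedBall 0 1) = 1 :=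
  Measure.addHaarMeasure_self (K₀ := padicUnitBall p)

/-- `ℤ_p` is the disjoint union of the `p` residue classes modulo `p`. -/
theorem padicHaar_smul_unitBall :
    (p : ℝ≥0∞) * padicHaar p ((p : ℚ_[p]) • Metric.closedBall (0 : ℚ_[p]) 1) = 1 := by
  have hp : (p : ℚ_[p]) ≠ 0 := by exact_mod_cast (Fact.out : p.Prime).ne_zero
  have hmem : ∀ x : ℚ_[p], x ∈ (p : ℚ_[p]) • Metric.closedBall (0 : ℚ_[p]) 1 ↔ ‖x‖ < 1 := by
    intro x
    rw [mem_smul_set_iff_inv_smul_mem₀ hp, mem_closedBall_zero_iff, smul_eq_mul, norm_mul,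
      norm_inv, Padic.norm_p, inv_inv]
    have hp0 : (0 : ℝ) < p := by exact_mod_cast (Fact.out : p.Prime).pos
    constructor
    · intro h
      have hp1 : (1 : ℝ) < p := by exact_mod_cast (Fact.out : p.Prime).one_lt
      nlinarith [norm_nonneg x]
    · intro h
      have := (Padic.norm_le_pow_iff_norm_lt_pow_add_one x (-1)).2 (by simpa using h)
      rw [zpow_neg_one] at this
      calc (p : ℝ) * ‖x‖ ≤ p * (p : ℝ)⁻¹ := by gcongr
        _ = 1 := mul_inv_cancel₀ hp0.ne'
  have hunion : Metric.closedBall (0 : ℚ_[p]) 1 = ⋃ a ∈ Finset.range p,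
      ((a : ℚ_[p]) +ᵥ ((p : ℚ_[p]) • Metric.closedBall (0 : ℚ_[p]) 1)) := by
    ext x
    simp only [mem_iUnion, mem_vadd_set_iff_neg_vadd_mem, hmem, vadd_eq_add, exists_prop,
      mem_closedBall_zero_iff, Finset.mem_range]
    constructor
    · intro hx
      obtain ⟨n, hn, hxn⟩ := PadicInt.exists_mem_range (⟨x, hx⟩ : ℤ_[p])
      refine ⟨n, hn, ?_⟩
      have h1 := PadicInt.mem_nonunits.1 ((IsLocalRing.mem_maximalIdeal _).1 hxn)
      have h2 : ‖x - n‖ < 1 := by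
        have h3 : ((⟨x, hx⟩ - n : ℤ_[p]) : ℚ_[p]) = x - n := rfl
        rwa [PadicInt.norm_def, h3] at h1
      rwa [neg_add_eq_sub]
    · rintro ⟨n, -, hx⟩
      have h1 : ‖(n : ℚ_[p])‖ ≤ 1 := by exact_mod_cast Padic.norm_int_le_one (p := p) n
      have h2 : x = n + (-n + x) := by ring
      rw [h2]
      exact (Padic.nonarchimedean _ _).trans (max_le h1 hx.le)
  have hdisj : Set.PairwiseDisjoint (Finset.range p : Set ℕ) fun a =>
      ((a : ℚ_[p]) +ᵥ ((p : ℚ_[p]) • Metric.closedBall (0 : ℚ_[p]) 1)) := by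
    intro a ha b hb hab
    rw [Function.onFun, Set.disjoint_left]
    intro x hxa hxb
    rw [mem_vadd_set_iff_neg_vadd_mem, hmem, vadd_eq_add] at hxa hxb
    have h1 : ‖((a - b : ℤ) : ℚ_[p])‖ < 1 := by
      have h2 : ((a - b : ℤ) : ℚ_[p]) = (-b + x) + -(-a + x) := by push_cast; ring
      rw [h2]
      exact (Padic.nonarchimedean _ _).trans_lt (max_lt hxb (by rwa [norm_neg]))
    rw [Padic.norm_intCast_lt_one_iff] at h1
    rw [Finset.coe_range, mem_Iio] at ha hb
    refine hab ?_
    have h3 : (a : ℤ) - b = 0 := Int.eq_zero_of_abs_lt_dvd h1 (by rw [abs_lt]; omega)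
    omega
  have hmeas : MeasurableSet ((p : ℚ_[p]) • Metric.closedBall (0 : ℚ_[p]) 1) :=
    Metric.isClosed_closedBall.measurableSet.const_smul₀ _
  have h1 := padicHaar_closedBall_one p
  rw [hunion, measure_biUnion_finset hdisj fun a _ => hmeas.const_vadd _] at h1
  simpa [measure_vadd] using h1

/-- Multiplication by `d` scales the Haar measure of `ℚ_p` by `|d|_p`. -/
theorem distribHaarChar_padic (d : ℚ_[p]ˣ) : distribHaarChar ℚ_[p] d = ‖(d : ℚ_[p])‖₊ := by
  have hp : (p : ℚ_[p]) ≠ 0 := by exact_mod_cast (Fact.out : p.Prime).ne_zero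
  have hball := padicHaar_closedBall_one p
  have huniv : ∀ u : ℚ_[p]ˣ, ‖(u : ℚ_[p])‖ = 1 → distribHaarChar ℚ_[p] u = 1 := by
    intro u hu
    refine distribHaarChar_eq_of_measure_smul_eq_mul (μ := padicHaar p)
      (s := Metric.closedBall (0 : ℚ_[p]) 1) (by simp [hball]) (by simp [hball]) ?_
    have h1 : u • Metric.closedBall (0 : ℚ_[p]) 1 = Metric.closedBall (0 : ℚ_[p]) 1 := by
      ext x
      rw [mem_smul_set_iff_inv_smul_mem, mem_closedBall_zero_iff, mem_closedBall_zero_iff,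
        Units.smul_def, norm_smul, Units.val_inv_eq_inv_val, norm_inv, hu]
      simp
    rw [h1]; simp
  have hpchar : distribHaarChar ℚ_[p] (Units.mk0 (p : ℚ_[p]) hp) = ‖(p : ℚ_[p])‖₊ := by
    refine distribHaarChar_eq_of_measure_smul_eq_mul (μ := padicHaar p)
      (s := Metric.closedBall (0 : ℚ_[p]) 1) (by simp [hball]) (by simp [hball]) ?_
    have h1 := padicHaar_smul_unitBall p
    have h2 : ‖(p : ℚ_[p])‖₊ = (p : ℝ≥0)⁻¹ := by
      ext; simp
    have hp0 : (p : ℝ≥0) ≠ 0 := by exact_mod_cast (Fact.out : p.Prime).ne_zero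
    rw [hball, mul_one, h2, ENNReal.coe_inv hp0]
    exact ENNReal.eq_inv_of_mul_eq_one_left (by rw [mul_comm]; exact_mod_cast h1)
  set k := (d : ℚ_[p]).valuation with hk
  have hd : d = Units.mk0 (p : ℚ_[p]) hp ^ k * (Units.mk0 (p : ℚ_[p]) hp ^ (-k) * d) := by
    rw [← mul_assoc, ← zpow_add]; simp
  have hdn : ‖(d : ℚ_[p])‖ = (p : ℝ) ^ (-k) := Padic.norm_eq_zpow_neg_valuation d.ne_zero
  have hp0 : (p : ℝ) ≠ 0 := by exact_mod_cast (Fact.out : p.Prime).ne_zero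
  rw [hd, map_mul, map_zpow, hpchar, huniv _ ?_, mul_one]
  · rw [← hd]
    ext
    simp [hdn]
  · simp only [Units.val_mul, Units.val_zpow_eq_zpow_val, Units.val_mk0, norm_mul, norm_zpow,
      Padic.norm_p, hdn]
    rw [inv_zpow', neg_neg, ← zpow_add₀ hp0]; simp

theorem padicHaar_mul_image_unitBall {d : ℚ_[p]} (hd : d ≠ 0) :
    padicHaar p ((fun x => d * x) '' Metric.closedBall 0 1) = ‖d‖₊ := by
  have h := distribHaarChar_mul (padicHaar p) (Units.mk0 d hd) (Metric.closedBall (0 : ℚ_[p]) 1)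
  rw [distribHaarChar_padic, padicHaar_closedBall_one, mul_one] at h
  exact h.symm

end Padic

section Cell

variable (S : Finset Nat.Primes)

instance haarQS_isAddHaarMeasure : (haarQS S).IsAddHaarMeasure := by
  unfold haarQS; infer_instance

instance pi_haarQS_isAddHaarMeasure (r : ℕ) :
    (Measure.pi fun _ : Fin r => haarQS S).IsAddHaarMeasure :=
  Measure.pi.isAddHaarMeasure _

instance pi_haarQS_regular (r : ℕ) : (Measure.pi fun _ : Fin r => haarQS S).Regular :=
  Measure.Regular.of_sigmaCompactSpace_of_isLocallyFiniteMeasure _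

/-- The set `[0, 1) × ∏ ℤ_p`, a fundamental domain for `ℤ_S` in `ℚ_S`. -/
def unitCell : Set (QS S) :=
  Ico (0 : ℝ) 1 ×ˢ univ.pi fun p : S => Metric.closedBall (0 : ℚ_[(p : Nat.Primes)]) 1

/-- The product of `r` copies of the unit cell. -/
def unitCube (r : ℕ) : Set (Fin r → QS S) := univ.pi fun _ => unitCell S

theorem measurableSet_unitCell : MeasurableSet (unitCell S) :=
  measurableSet_Ico.prod (MeasurableSet.univ_pi fun _ => Metric.isClosed_closedBall.measurableSet)

theorem measurableSet_unitCube (r : ℕ) : MeasurableSet (unitCube S r) :=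
  MeasurableSet.univ_pi fun _ => measurableSet_unitCell S

theorem haarQS_unitCell : haarQS S (unitCell S) = 1 := by
  rw [haarQS, unitCell, Measure.prod_prod, Measure.pi_pi]
  simp [padicHaar_closedBall_one]

theorem pi_haarQS_unitCube (r : ℕ) : (Measure.pi fun _ : Fin r => haarQS S) (unitCube S r) = 1 := by
  rw [unitCube, Measure.pi_pi]
  simp [haarQS_unitCell]

variable {S}

theorem haarQS_mul_image_unitCell {d : QS S} (h2 : ∀ p, d.2 p ≠ 0) :
    haarQS S ((fun x => d * x) '' unitCell S) = ENNReal.ofReal (|d.1| * ∏ p, ‖d.2 p‖) := by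
  have himg : (fun x => d * x) '' unitCell S = ((fun x => d.1 * x) '' Ico (0 : ℝ) 1) ×ˢ
      univ.pi fun p : S => (fun x => d.2 p * x) '' Metric.closedBall 0 1 := by
    ext y
    constructor
    · rintro ⟨x, hx, rfl⟩
      exact ⟨⟨x.1, hx.1, rfl⟩, fun p _ => ⟨x.2 p, hx.2 p trivial, rfl⟩⟩
    · rintro ⟨⟨x, hx, hxy⟩, h⟩
      choose z hz hzy using fun p => h p trivial
      exact ⟨(x, z), ⟨hx, fun p _ => hz p⟩, Prod.ext hxy (funext hzy)⟩
  rw [himg, haarQS, Measure.prod_prod, Measure.pi_pi]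
  have hvol : volume ((fun x => d.1 * x) '' Ico (0 : ℝ) 1) = ENNReal.ofReal |d.1| := by
    have := Measure.addHaar_smul (volume : Measure ℝ) d.1 (Ico (0 : ℝ) 1)
    simpa [← image_smul] using this
  rw [hvol, ENNReal.ofReal_mul (abs_nonneg _),
    ENNReal.ofReal_prod_of_nonneg fun _ _ => norm_nonneg _]
  congr 1
  refine Finset.prod_congr rfl fun p _ => ?_
  rw [padicHaar_mul_image_unitBall _ (h2 p), ofReal_norm]
  rfl

end Cell

section Scale

variable {S : Finset Nat.Primes} {r : ℕ}

/-- The homeomorphism underlying a linear automorphism of `ℚ_S ^ r`. -/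
def toContinuousAddEquiv (e : (Fin r → QS S) ≃ₗ[QS S] (Fin r → QS S)) :
    (Fin r → QS S) ≃ₜ+ (Fin r → QS S) :=
  { e.toAddEquiv with
    continuous_toFun := e.toLinearMap.continuous_on_pi
    continuous_invFun := e.symm.toLinearMap.continuous_on_pi }

/-- The factor by which a linear automorphism of `ℚ_S ^ r` scales the Haar measure. -/
def linScale (e : (Fin r → QS S) ≃ₗ[QS S] (Fin r → QS S)) : ℝ≥0 :=
  addEquivAddHaarChar (toContinuousAddEquiv e)

theorem pi_haarQS_image (e : (Fin r → QS S) ≃ₗ[QS S] (Fin r → QS S)) (E : Set (Fin r → QS S)) :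
    (Measure.pi fun _ : Fin r => haarQS S) (e '' E) =
      linScale e * (Measure.pi fun _ : Fin r => haarQS S) E := by
  have h := addEquivAddHaarChar_smul_preimage (Measure.pi fun _ : Fin r => haarQS S)
    (X := e '' E) (toContinuousAddEquiv e)
  have h2 : (toContinuousAddEquiv e) ⁻¹' (e '' E) = E := preimage_image_eq E e.injective
  rw [h2] at h
  exact h.symm

theorem linScale_eq (e : (Fin r → QS S) ≃ₗ[QS S] (Fin r → QS S)) :
    (linScale e : ℝ≥0∞) = (Measure.pi fun _ : Fin r => haarQS S) (e '' unitCube S r) := by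
  rw [pi_haarQS_image, pi_haarQS_unitCube, mul_one]

theorem linScale_trans (e f : (Fin r → QS S) ≃ₗ[QS S] (Fin r → QS S)) :
    linScale (e.trans f) = linScale e * linScale f :=
  addEquivAddHaarChar_trans (φ := toContinuousAddEquiv f) (ψ := toContinuousAddEquiv e)

theorem linScale_eq_prod_of_diagonal (e : (Fin r → QS S) ≃ₗ[QS S] (Fin r → QS S))
    (d : Fin r → QS S) (hd2 : ∀ i p, (d i).2 p ≠ 0)
    (he : ∀ x i, e x i = d i * x i) :
    (linScale e : ℝ≥0∞) = ∏ i, ENNReal.ofReal (|(d i).1| * ∏ p, ‖(d i).2 p‖) := by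
  have himg : e '' unitCube S r = univ.pi fun i => (fun x => d i * x) '' unitCell S := by
    ext y
    constructor
    · rintro ⟨x, hx, rfl⟩ i -
      exact ⟨x i, hx i trivial, (he x i).symm⟩
    · intro hy
      choose x hx hxy using fun i => hy i trivial
      exact ⟨x, fun i _ => hx i, funext fun i => (he x i).trans (hxy i)⟩
  rw [linScale_eq, himg, Measure.pi_pi]
  exact Finset.prod_congr rfl fun i _ => haarQS_mul_image_unitCell (hd2 i)

/-- Adding a coordinate that is left fixed does not change the scaling factor. -/
theorem linScale_cons (e : (Fin r → QS S) ≃ₗ[QS S] (Fin r → QS S))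
    (f : (Fin (r + 1) → QS S) ≃ₗ[QS S] (Fin (r + 1) → QS S))
    (hf : ∀ y, f y = Fin.cons (y 0) (e (Fin.tail y))) : linScale f = linScale e := by
  have hmp := measurePreserving_piFinSuccAbove (fun _ : Fin (r + 1) => haarQS S) 0
  have himg : f '' unitCube S (r + 1) = MeasurableEquiv.piFinSuccAbove (fun _ => QS S) 0 ⁻¹'
      (unitCell S ×ˢ (e '' unitCube S r)) := by
    ext z
    constructor
    · rintro ⟨y, hy, rfl⟩
      rw [hf]
      exact ⟨hy 0 trivial, ⟨Fin.tail y, fun i _ => hy i.succ trivial, rfl⟩⟩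
    · rintro ⟨h0, x, hx, hxz⟩
      refine ⟨Fin.cons (z 0) x, fun i _ => ?_, ?_⟩
      · refine Fin.cases ?_ (fun j => ?_) i
        · exact h0
        · exact hx j trivial
      · rw [hf]
        funext i
        refine Fin.cases rfl (fun j => ?_) i
        exact congrFun hxz j
  have : (linScale f : ℝ≥0∞) = linScale e := by
    rw [linScale_eq, himg, hmp.measure_preimage_equiv, Measure.prod_prod, haarQS_unitCell, one_mul,
      linScale_eq]
  exact_mod_cast this

/-- Hadamard's inequality for real matrices. -/
theorem abs_det_le_one_of_columns (A : Matrix (Fin r) (Fin r) ℝ) (hA : ∀ i, ∑ j, A j i ^ 2 ≤ 1) :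
    |A.det| ≤ 1 := by
  have : Fact (Module.finrank ℝ (EuclideanSpace ℝ (Fin r)) = r) := ⟨by simp⟩
  set b := EuclideanSpace.basisFun (Fin r) ℝ
  have h := b.toBasis.orientation.abs_volumeForm_apply_le
    fun i => (WithLp.toLp 2 fun j => A j i : EuclideanSpace ℝ (Fin r))
  rw [Orientation.volumeForm_robust _ b rfl, Module.Basis.det_apply] at h
  have hM : b.toBasis.toMatrix
      (fun i => (WithLp.toLp 2 fun j => A j i : EuclideanSpace ℝ (Fin r))) = A := by
    ext i j
    simp [b, Module.Basis.toMatrix_apply]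
  rw [hM] at h
  refine h.trans (Finset.prod_le_one (fun _ _ => norm_nonneg _) fun i _ => ?_)
  rw [EuclideanSpace.norm_eq, Real.sqrt_le_one]
  simpa using hA i

/-- The image of the Haar measure on `ℝ ^ r × ∏ ℤ_p ^ r` under the projection to `ℝ ^ r` is
Lebesgue measure, so that a cylinder over `E` has measure at most that of `E`. -/
theorem pi_haarQS_arch_le (E : Set (Fin r → ℝ)) :
    (Measure.pi fun _ : Fin r => haarQS S)
      {y | (fun j => (y j).1) ∈ E ∧ ∀ j p, ‖(y j).2 p‖ ≤ 1} ≤ volume E := by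
  set Z : Set (QS S) := univ ×ˢ univ.pi fun p : S =>
    Metric.closedBall (0 : ℚ_[(p : Nat.Primes)]) 1 with hZ
  have hmapfst : ((haarQS S).restrict Z).map Prod.fst = volume := by
    rw [hZ, haarQS, ← Measure.prod_restrict, Measure.map_fst_prod]
    simp [Measure.pi_pi, padicHaar_closedBall_one]
  have hmap : (((Measure.pi fun _ : Fin r => haarQS S).restrict (univ.pi fun _ => Z)).map
      fun y j => (y j).1) = volume := by
    have : ∀ i : Fin r, SigmaFinite (((haarQS S).restrict Z).map Prod.fst) := fun _ => by
      rw [hmapfst]; infer_instance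
    rw [Measure.restrict_pi_pi]
    refine (Measure.pi_map_pi (X := fun _ => QS S) (Y := fun _ => ℝ) (f := fun _ => Prod.fst)
      (μ := fun _ => (haarQS S).restrict Z) (hμ := this)
      fun _ => measurable_fst.aemeasurable).trans ?_
    rw [hmapfst]
    rfl
  rw [← hmap]
  refine le_trans ?_ (Measure.le_map_apply
    (measurable_pi_lambda _ fun j => measurable_fst.comp (measurable_pi_apply j)).aemeasurable E)
  rw [Measure.restrict_apply']
  · refine measure_mono fun y hy => ⟨hy.1, fun j _ => ⟨trivial, fun p _ => ?_⟩⟩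
    exact mem_closedBall_zero_iff.2 (hy.2 j p)
  · exact MeasurableSet.univ_pi fun _ => MeasurableSet.univ.prod
      (MeasurableSet.univ_pi fun _ => Metric.isClosed_closedBall.measurableSet)

/-- Automorphisms whose columns have norm at most one at all places do not increase volumes. -/
theorem linScale_le_one (e : (Fin r → QS S) ≃ₗ[QS S] (Fin r → QS S))
    (h1 : ∀ i, ∑ j, (e (Pi.single i 1) j).1 ^ 2 ≤ 1)
    (h2 : ∀ i j p, ‖(e (Pi.single i 1) j).2 p‖ ≤ 1) : linScale e ≤ 1 := by
  set A : Matrix (Fin r) (Fin r) ℝ := fun j i => (e (Pi.single i 1) j).1 with hA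
  have hexp : ∀ x j, e x j = ∑ i, x i * e (Pi.single i 1) j := by
    intro x j
    conv_lhs => rw [pi_eq_sum_univ' x, map_sum]
    simp [Finset.sum_apply]
  have hsub : e '' unitCube S r ⊆
      {y | (fun j => (y j).1) ∈ Matrix.toLin' A '' (univ.pi fun _ => Ico (0 : ℝ) 1) ∧
        ∀ j p, ‖(y j).2 p‖ ≤ 1} := by
    rintro _ ⟨x, hx, rfl⟩
    refine ⟨⟨fun i => (x i).1, fun i _ => (hx i trivial).1, ?_⟩, fun j p => ?_⟩
    · funext j
      rw [Matrix.toLin'_apply, Matrix.mulVec, dotProduct, hexp, Prod.fst_sum]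
      simp [hA, mul_comm]
    · rw [hexp, Prod.snd_sum, Finset.sum_apply]
      refine IsUltrametricDist.norm_sum_le_of_forall_le_of_nonneg zero_le_one fun i _ => ?_
      rw [Prod.snd_mul, Pi.mul_apply, norm_mul]
      exact mul_le_one₀ (mem_closedBall_zero_iff.1 ((hx i trivial).2 p trivial)) (norm_nonneg _)
        (h2 i j p)
  have : (linScale e : ℝ≥0∞) ≤ 1 := by
    rw [linScale_eq]
    refine (measure_mono hsub).trans ((pi_haarQS_arch_le _).trans ?_)
    rw [Measure.addHaar_image_linearMap, LinearMap.det_toLin', volume_pi_pi]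
    simpa using abs_det_le_one_of_columns A h1
  exact_mod_cast this

theorem norm_archPart_sq (x : Fin r → QS S) : ‖archPart x‖ ^ 2 = ∑ j, (x j).1 ^ 2 := by
  rw [EuclideanSpace.norm_sq_eq]
  simp [archPart]

/-- Hadamard's inequality over `ℚ_S`: the scaling factor of an automorphism is at most the product
of the contents of its columns. The columns are first normalized, at all places at once, to have
norm one. -/
theorem linScale_le_prod_content (e : (Fin r → QS S) ≃ₗ[QS S] (Fin r → QS S))
    (h1 : ∀ i, archPart (e (Pi.single i 1)) ≠ 0) (h2 : ∀ i p, padicPart p (e (Pi.single i 1)) ≠ 0) :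
    (linScale e : ℝ≥0∞) ≤ ENNReal.ofReal (∏ i, content (e (Pi.single i 1))) := by
  have hcoord : ∀ i (p : S), ∃ j,
      ‖padicPart p (e (Pi.single i 1))‖ = ‖(e (Pi.single i 1) j).2 p‖ := by
    intro i p
    have : Nonempty (Fin r) := ⟨i⟩
    obtain ⟨j, hj⟩ := Finite.exists_max fun j => ‖padicPart p (e (Pi.single i 1)) j‖
    refine ⟨j, le_antisymm ?_ (norm_le_pi_norm (padicPart p (e (Pi.single i 1))) j)⟩
    exact (pi_norm_le_iff_of_nonneg (norm_nonneg _)).2 hj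
  choose j hj using hcoord
  set d : Fin r → QS S := fun i =>
    (‖archPart (e (Pi.single i 1))‖, fun p => (e (Pi.single i 1) (j i p)).2 p) with hd
  set d' : Fin r → QS S := fun i => ((d i).1⁻¹, fun p => ((d i).2 p)⁻¹) with hd'
  have hd1 : ∀ i, (d i).1 ≠ 0 := fun i => norm_ne_zero_iff.2 (h1 i)
  have hd2n : ∀ i p, ‖(d i).2 p‖ = ‖padicPart p (e (Pi.single i 1))‖ := fun i p => (hj i p).symm
  have hd2 : ∀ i p, (d i).2 p ≠ 0 := fun i p => by
    rw [← norm_ne_zero_iff, hd2n]; exact norm_ne_zero_iff.2 (h2 i p)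
  have hdd' : ∀ i, d i * d' i = 1 := fun i =>
    Prod.ext (mul_inv_cancel₀ (hd1 i)) (funext fun p => mul_inv_cancel₀ (hd2 i p))
  let D : (Fin r → QS S) ≃ₗ[QS S] (Fin r → QS S) :=
    { toFun := fun x i => d i * x i
      map_add' := fun x y => by funext i; simp [mul_add]
      map_smul' := fun c x => by funext i; simp [mul_left_comm]
      invFun := fun x i => d' i * x i
      left_inv := fun x => by
        funext i
        change d' i * (d i * x i) = x i
        rw [← mul_assoc, mul_comm (d' i), hdd', one_mul]
      right_inv := fun x => by
        funext i
        change d i * (d' i * x i) = x i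
        rw [← mul_assoc, hdd', one_mul] }
  have hDsymm : ∀ i, D.symm (Pi.single i 1) = d' i • Pi.single i 1 := by
    intro i
    funext k
    change d' k * Pi.single (M := fun _ => QS S) i 1 k = d' i * Pi.single (M := fun _ => QS S) i 1 k
    by_cases h : k = i
    · rw [h]
    · simp [h]
  have hcol : ∀ i, (D.symm.trans e) (Pi.single i 1) = d' i • e (Pi.single i 1) := by
    intro i
    rw [LinearEquiv.trans_apply, hDsymm, map_smul]
  have hU : linScale (D.symm.trans e) ≤ 1 := by
    refine linScale_le_one _ (fun i => ?_) fun i k p => ?_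
    · rw [hcol]
      have : ∀ k, ((d' i • e (Pi.single i 1)) k).1 = (d i).1⁻¹ * (e (Pi.single i 1) k).1 :=
        fun k => rfl
      simp only [this, mul_pow]
      rw [← Finset.mul_sum, ← norm_archPart_sq]
      rw [← mul_pow, inv_mul_cancel₀ (hd1 i), one_pow]
    · rw [hcol]
      change ‖((d i).2 p)⁻¹ * (e (Pi.single i 1) k).2 p‖ ≤ 1
      rw [norm_mul, norm_inv, hd2n, inv_mul_le_one₀ (norm_pos_iff.2 (h2 i p))]
      exact norm_le_pi_norm (padicPart p (e (Pi.single i 1))) k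
  have hfac : linScale e = linScale D * linScale (D.symm.trans e) := by
    rw [← linScale_trans]
    congr 1
    ext1 x
    simp
  have hDs := linScale_eq_prod_of_diagonal D d hd2 fun x i => rfl
  have hle : (linScale e : ℝ≥0∞) ≤ linScale D := by
    exact_mod_cast hfac ▸ mul_le_of_le_one_right' hU
  refine hle.trans (le_of_eq ?_)
  rw [hDs, ENNReal.ofReal_prod_of_nonneg fun i _ => by unfold content; positivity]
  refine Finset.prod_congr rfl fun i _ => ?_
  rw [content]
  congr 2
  · exact abs_of_nonneg (norm_nonneg _)
  · exact Finset.prod_congr rfl fun p _ => hd2n i p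

end Scale

end

/-! ### The lattice `ℤ_S ^ m` and its primitive submodules -/

section Arithmetic

theorem not_dvd_den_of_norm_le_one {p : ℕ} [Fact p.Prime] {x : ℚ} (h : ‖(x : ℚ_[p])‖ ≤ 1) :
    ¬ p ∣ x.den := by
  have h1 := PadicInt.isUnit_iff.1 (PadicInt.isUnit_den x h)
  intro hd
  have h2 : ‖((x.den : ℤ) : ℚ_[p])‖ < 1 := Padic.norm_intCast_lt_one_iff.2 (by exact_mod_cast hd)
  rw [PadicInt.norm_def] at h1
  push_cast at h1 h2
  exact absurd h1 h2.ne

/-- A rational number that is integral at all primes is an integer. -/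
theorem exists_int_eq_of_norm_le_one {x : ℚ} (h : ∀ p : Nat.Primes, ‖(x : ℚ_[p])‖ ≤ 1) :
    ∃ n : ℤ, x = n := by
  refine ⟨x.num, ?_⟩
  have hden : x.den = 1 := by
    by_contra hne
    obtain ⟨p, hp, hpd⟩ := Nat.exists_prime_and_dvd hne
    have := h ⟨p, hp⟩
    have hf : Fact p.Prime := ⟨hp⟩
    exact not_dvd_den_of_norm_le_one this hpd
  exact ((Rat.den_eq_one_iff x).1 hden).symm

theorem norm_natCast_eq_one_of_ne {p q : Nat.Primes} (h : p ≠ q) :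
    ‖((p : ℕ) : ℚ_[q])‖ = 1 := by
  refine le_antisymm (by exact_mod_cast Padic.norm_int_le_one (p := q) (p : ℕ)) ?_
  by_contra! hlt
  have h1 : ‖(((p : ℕ) : ℤ) : ℚ_[q])‖ < 1 := by exact_mod_cast hlt
  rw [Padic.norm_intCast_lt_one_iff] at h1
  have h2 : (q : ℕ) ∣ (p : ℕ) := by exact_mod_cast h1
  exact h (Subtype.ext ((Nat.prime_dvd_prime_iff_eq q.2 p.2).1 h2).symm)

/-- Approximation of a `p`-adic number by an element of `ℤ[1/p]`. -/
theorem exists_rat_sub_norm_le_one (p : Nat.Primes) (x : ℚ_[p]) :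
    ∃ a : ℚ, ‖x - (a : ℚ_[p])‖ ≤ 1 ∧ ∀ q : Nat.Primes, q ≠ p → ‖(a : ℚ_[q])‖ ≤ 1 := by
  have hp0 : ((p : ℕ) : ℚ_[p]) ≠ 0 := by exact_mod_cast p.2.ne_zero
  have hpR : (0 : ℝ) < (p : ℕ) := by exact_mod_cast p.2.pos
  obtain ⟨n, hn⟩ := pow_unbounded_of_one_lt ‖x‖
    (by exact_mod_cast p.2.one_lt : (1 : ℝ) < ((p : ℕ) : ℝ))
  have hz : ‖x * ((p : ℕ) : ℚ_[p]) ^ n‖ ≤ 1 := by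
    rw [norm_mul, norm_pow, Padic.norm_p, inv_pow]
    rw [mul_inv_le_iff₀ (by positivity), one_mul]
    exact hn.le
  set z : ℤ_[p] := ⟨_, hz⟩ with hzdef
  have happr := (PadicInt.norm_le_pow_iff_mem_span_pow _ n).2 (z.appr_spec n)
  have h1 : ‖x * ((p : ℕ) : ℚ_[p]) ^ n - (z.appr n : ℚ_[p])‖ ≤ ((p : ℕ) : ℝ) ^ (-n : ℤ) := by
    rw [PadicInt.norm_def] at happr
    exact happr
  refine ⟨(z.appr n : ℚ) / ((p : ℕ) : ℚ) ^ n, ?_, fun q hq => ?_⟩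
  · have h2 : x - (((z.appr n : ℚ) / ((p : ℕ) : ℚ) ^ n : ℚ) : ℚ_[p]) =
        (x * ((p : ℕ) : ℚ_[p]) ^ n - (z.appr n : ℚ_[p])) / ((p : ℕ) : ℚ_[p]) ^ n := by
      push_cast
      field_simp
    rw [h2, norm_div, norm_pow, Padic.norm_p, inv_pow, div_inv_eq_mul]
    rw [zpow_neg, zpow_natCast] at h1
    calc _ ≤ (((p : ℕ) : ℝ) ^ n)⁻¹ * ((p : ℕ) : ℝ) ^ n := by gcongr
      _ = 1 := inv_mul_cancel₀ (by positivity)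
  · push_cast
    rw [norm_div, norm_pow, norm_natCast_eq_one_of_ne hq.symm, one_pow, div_one]
    exact_mod_cast Padic.norm_int_le_one (p := q) (z.appr n)

variable {S : Finset Nat.Primes}

/-- The zero element is the only element of `ℤ_S` whose real component has absolute value less than
`1` and which is `p`-integral for all `p ∈ S`. -/
theorem ZS_eq_zero_of_small {γ : ZS S} (h1 : |((γ : ℚ) : ℝ)| < 1)
    (h2 : ∀ p : S, ‖((γ : ℚ) : ℚ_[(p : Nat.Primes)])‖ ≤ 1) : γ = 0 := by
  obtain ⟨n, hn⟩ := exists_int_eq_of_norm_le_one (x := (γ : ℚ)) fun p => by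
    by_cases hp : p ∈ S
    exacts [h2 ⟨p, hp⟩, γ.2 p hp]
  rw [hn] at h1
  have hn0 : n = 0 := by
    rw [← Int.abs_lt_one_iff]
    exact_mod_cast h1
  apply Subtype.ext
  rw [hn, hn0]
  simp

/-- The translates of the unit cell by `ℤ_S` tile `ℚ_S`. -/
theorem existsUnique_add_mem_unitCell (x : QS S) :
    ∃! γ : ZS S, algebraMap (ZS S) (QS S) γ + x ∈ unitCell S := by
  choose a ha1 ha2 using fun p : S => exists_rat_sub_norm_le_one p (x.2 p)
  have hsum_mem : ∑ p, a p ∈ ZS S := by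
    refine Subring.sum_mem _ fun p _ q hq => ha2 p q ?_
    rintro rfl
    exact hq p.2
  set n : ℤ := ⌊x.1 - ((∑ p, a p : ℚ) : ℝ)⌋ with hn
  refine existsUnique_of_exists_of_unique ⟨-⟨∑ p, a p, hsum_mem⟩ - (n : ZS S), ?_⟩ ?_
  · have hval : ((-⟨∑ p, a p, hsum_mem⟩ - (n : ZS S) : ZS S) : ℚ) = -∑ p, a p - n := by
      push_cast; rfl
    refine ⟨?_, fun p _ => ?_⟩
    · change ((-⟨∑ p, a p, hsum_mem⟩ - (n : ZS S) : ZS S) : ℚ) + x.1 ∈ Ico (0 : ℝ) 1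
      rw [hval]
      push_cast
      have h1 := Int.floor_le (x.1 - ((∑ p, a p : ℚ) : ℝ))
      have h2 := Int.lt_floor_add_one (x.1 - ((∑ p, a p : ℚ) : ℝ))
      rw [← hn] at h1 h2
      push_cast at h1 h2
      constructor <;> linarith
    · rw [mem_closedBall_zero_iff]
      change ‖((((-⟨∑ p, a p, hsum_mem⟩ - (n : ZS S) : ZS S) : ℚ)) : ℚ_[(p : Nat.Primes)]) +
        x.2 p‖ ≤ 1
      rw [hval, ← Finset.add_sum_erase _ _ (Finset.mem_univ p)]
      push_cast
      have h3 : -((a p : ℚ_[(p : Nat.Primes)]) + ∑ q ∈ Finset.univ.erase p,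
            (a q : ℚ_[(p : Nat.Primes)])) - (n : ℚ_[(p : Nat.Primes)]) + x.2 p =
          (x.2 p - a p) + -(∑ q ∈ Finset.univ.erase p, (a q : ℚ_[(p : Nat.Primes)]) + n) := by
        ring
      rw [h3]
      refine (Padic.nonarchimedean _ _).trans (max_le (ha1 p) ?_)
      rw [norm_neg]
      refine (Padic.nonarchimedean _ _).trans (max_le ?_ (Padic.norm_int_le_one n))
      refine IsUltrametricDist.norm_sum_le_of_forall_le_of_nonneg zero_le_one fun q hq => ?_
      refine ha2 q p fun h => ?_
      exact (Finset.mem_erase.1 hq).1 (Subtype.ext h.symm)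
  · intro γ γ' hγ hγ'
    rw [← sub_eq_zero]
    refine ZS_eq_zero_of_small ?_ fun p => ?_
    · have h3 : (((γ - γ' : ZS S) : ℚ) : ℝ) = ((γ : ℚ) + x.1) - ((γ' : ℚ) + x.1) := by
        push_cast; ring
      have h4 : (((γ : ℚ) : ℝ) + x.1) ∈ Ico (0 : ℝ) 1 := hγ.1
      have h5 : (((γ' : ℚ) : ℝ) + x.1) ∈ Ico (0 : ℝ) 1 := hγ'.1
      rw [h3, abs_lt]
      constructor <;> linarith [h4.1, h4.2, h5.1, h5.2]
    · have h3 : (((γ - γ' : ZS S) : ℚ) : ℚ_[(p : Nat.Primes)]) =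
          ((γ : ℚ) + x.2 p) + -((γ' : ℚ) + x.2 p) := by
        push_cast; ring
      rw [h3]
      refine (Padic.nonarchimedean _ _).trans (max_le ?_ ?_)
      · exact mem_closedBall_zero_iff.1 (hγ.2 p trivial)
      · rw [norm_neg]
        exact mem_closedBall_zero_iff.1 (hγ'.2 p trivial)

/-- Every subring of `ℚ` is a principal ideal ring. -/
theorem isPrincipalIdealRing_subring_rat (R : Subring ℚ) : IsPrincipalIdealRing R := by
  refine ⟨fun I => ?_⟩
  -- denominators of elements of `R` are units of `R`
  have hden : ∀ x ∈ R, (x.den : ℚ)⁻¹ ∈ R := by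
    intro x hx
    have hcop : IsCoprime x.num (x.den : ℤ) := Int.isCoprime_iff_gcd_eq_one.2 x.reduced
    obtain ⟨u, w, huw⟩ := hcop
    have hd : (x.den : ℚ) ≠ 0 := by exact_mod_cast x.den_nz
    have h1 : (x.den : ℚ)⁻¹ = u * x + w := by
      have h2 : (u : ℚ) * x.num + w * x.den = 1 := by exact_mod_cast huw
      rw [inv_eq_iff_eq_inv, eq_comm, inv_eq_iff_eq_inv, eq_comm, inv_eq_one_div, ← h2, add_div,
        mul_div_assoc, Rat.num_div_den, mul_div_cancel_right₀ _ hd]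
    rw [h1]
    exact R.add_mem (R.mul_mem (intCast_mem R u) hx) (intCast_mem R w)
  obtain ⟨n, hn⟩ := (IsPrincipalIdealRing.principal (I.comap (Int.castRingHom R))).principal
  have hnI : (n : R) ∈ I := by
    have : n ∈ I.comap (Int.castRingHom R) := by rw [hn]; exact Submodule.mem_span_singleton_self n
    simpa using this
  refine ⟨(n : R), le_antisymm (fun x hx => ?_) ?_⟩
  · have hnum : (x : ℚ).num ∈ I.comap (Int.castRingHom R) := by
      have h1 : (((x : ℚ).num : ℤ) : R) = ((x : ℚ).den : R) * x := by
        apply Subtype.ext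
        push_cast
        exact (Rat.den_mul_eq_num _).symm
      rw [Ideal.mem_comap, eq_intCast, h1]
      exact I.mul_mem_left _ hx
    rw [hn] at hnum
    obtain ⟨k, hk⟩ := Submodule.mem_span_singleton.1 hnum
    refine Submodule.mem_span_singleton.2 ⟨(k : R) * ⟨_, hden x x.2⟩, ?_⟩
    apply Subtype.ext
    have h2 : (k : ℚ) * n = (x : ℚ).num := by exact_mod_cast hk
    rw [smul_eq_mul]
    push_cast
    rw [mul_right_comm, h2, ← div_eq_mul_inv, Rat.num_div_den]
  · rw [Submodule.span_singleton_le_iff_mem]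
    exact hnI

end Arithmetic

section Submodules

variable {S : Finset Nat.Primes} {m r : ℕ}

/-- The diagonal embedding of `ℚ ^ m` in `ℚ_S ^ m`. -/
def ratVec (S : Finset Nat.Primes) (m : ℕ) : (Fin m → ℚ) →ₗ[ℚ] (Fin m → QS S) :=
  (Algebra.linearMap ℚ (QS S)).compLeft (Fin m)

theorem ratVec_apply (v : Fin m → ℚ) (i : Fin m) :
    ratVec S m v i = algebraMap ℚ (QS S) (v i) := rfl

theorem ratVec_injective : Function.Injective (ratVec S m) := by
  intro v w h
  funext i
  exact (algebraMap ℚ (QS S)).injective (congrFun h i)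

theorem mem_stdLattice {x : Fin m → QS S} :
    x ∈ stdLattice S m ↔ ∃ v : Fin m → ℚ, (∀ i, v i ∈ ZS S) ∧ ratVec S m v = x := by
  constructor
  · rintro ⟨v, rfl⟩
    exact ⟨fun i => v i, fun i => (v i).2, rfl⟩
  · rintro ⟨v, hv, rfl⟩
    exact ⟨fun i => ⟨v i, hv i⟩, rfl⟩

/-- Rational vectors that are independent over `ℚ` are independent over `ℚ_S`. -/
theorem linearIndependent_ratVec {v : Fin r → Fin m → ℚ} (hv : LinearIndependent ℚ v) :
    LinearIndependent (QS S) fun i => ratVec S m (v i) := by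
  classical
  -- a rational left inverse of the linear combination map is applied to the coordinates
  obtain ⟨f, hf⟩ := (Fintype.linearCombination ℚ v).exists_leftInverse_of_injective
    (LinearMap.ker_eq_bot.2 hv.fintypeLinearCombination_injective)
  have hfv : ∀ i k, ∑ j, v i j * f (Pi.single j 1) k = if i = k then 1 else 0 := by
    intro i k
    have h1 : f (v i) = Pi.single i 1 := by
      have := LinearMap.congr_fun hf (Pi.single i 1)
      simpa [Fintype.linearCombination_apply_single] using this
    have h2 : f (v i) k = ∑ j, v i j * f (Pi.single j 1) k := by
      conv_lhs => rw [pi_eq_sum_univ' (v i), map_sum]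
      simp [Finset.sum_apply]
    rw [← h2, h1, Pi.single_apply]
    simp only [eq_comm]
  rw [Fintype.linearIndependent_iff]
  intro c hc k
  have h3 : ∑ j, (∑ i, c i • ratVec S m (v i)) j * algebraMap ℚ (QS S) (f (Pi.single j 1) k) =
      c k := by
    calc _ = ∑ j, ∑ i, c i * algebraMap ℚ (QS S) (v i j * f (Pi.single j 1) k) := by
          refine Finset.sum_congr rfl fun j _ => ?_
          rw [Finset.sum_apply, Finset.sum_mul]
          refine Finset.sum_congr rfl fun i _ => ?_
          rw [Pi.smul_apply, ratVec_apply, smul_eq_mul, mul_assoc, map_mul]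
      _ = ∑ i, c i * algebraMap ℚ (QS S) (∑ j, v i j * f (Pi.single j 1) k) := by
          rw [Finset.sum_comm]
          simp only [map_sum, Finset.mul_sum]
      _ = c k := by
          simp only [hfv, apply_ite (algebraMap ℚ (QS S)), map_one, map_zero, mul_ite, mul_one,
            mul_zero, Finset.sum_ite_eq', Finset.mem_univ, if_true]
  rw [← h3, hc]
  simp

instance isFractionRing_ZS (S : Finset Nat.Primes) : IsFractionRing (ZS S) ℚ :=
  IsFractionRing.of_field _ _ fun z => ⟨(z.num : ZS S), (z.den : ZS S), by
    change z = ((z.num : ZS S) : ℚ) / ((z.den : ZS S) : ℚ)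
    push_cast
    exact (Rat.num_div_den z).symm⟩

/-- A submodule of the standard lattice has a basis consisting of rational vectors. -/
theorem exists_rational_basis {Δ : Submodule (ZS S) (Fin m → QS S)} (hΔ : Δ ≤ stdLattice S m) :
    ∃ (r : ℕ) (v : Fin r → Fin m → ℚ), LinearIndependent ℚ v ∧
      Δ = Submodule.span (ZS S) (range fun i => ratVec S m (v i)) := by
  have := isPrincipalIdealRing_subring_rat (ZS S)
  set φ : (Fin m → ZS S) →ₗ[ZS S] (Fin m → QS S) :=
    (Algebra.linearMap (ZS S) (QS S)).compLeft (Fin m) with hφ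
  obtain ⟨r, b⟩ := Submodule.basisOfPid (Pi.basisFun (ZS S) (Fin m)) (Δ.comap φ)
  refine ⟨r, fun i j => ((b i : Fin m → ZS S) j : ℚ), ?_, ?_⟩
  · rw [← LinearIndependent.iff_fractionRing (ZS S) ℚ]
    have h1 := b.linearIndependent.map' (Submodule.subtype _) (Submodule.ker_subtype _)
    refine h1.map' ((Algebra.linearMap (ZS S) ℚ).compLeft (Fin m)) (LinearMap.ker_eq_bot.2 ?_)
    intro x y hxy
    funext j
    exact Subtype.ext (congrFun hxy j)
  · have h1 : Submodule.map φ (Δ.comap φ) = Δ := by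
      rw [Submodule.map_comap_eq, inf_eq_right]
      exact hΔ
    have h2 : Submodule.span (ZS S) (range fun i => (b i : Fin m → ZS S)) = Δ.comap φ := by
      have := congrArg (Submodule.map (Δ.comap φ).subtype) b.span_eq
      rw [Submodule.map_span, ← range_comp, Submodule.map_top, Submodule.range_subtype] at this
      exact this
    conv_lhs => rw [← h1, ← h2, Submodule.map_span, ← range_comp]
    rfl

theorem span_rat_eq_map {Δ : Submodule (ZS S) (Fin m → QS S)} {v : Fin r → Fin m → ℚ}
    (h : Δ = Submodule.span (ZS S) (range fun i => ratVec S m (v i))) :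
    Submodule.span ℚ (Δ : Set (Fin m → QS S)) =
      (Submodule.span ℚ (range v)).map (ratVec S m) := by
  rw [h, Submodule.span_span_of_tower, Submodule.map_span, ← range_comp]
  rfl

theorem span_QS_eq {M : Type*} [AddCommGroup M] [Module (ZS S) M] [Module (QS S) M]
    [IsScalarTower (ZS S) (QS S) M] {Δ : Submodule (ZS S) M} {w : Fin r → M}
    (h : Δ = Submodule.span (ZS S) (range w)) :
    Submodule.span (QS S) (Δ : Set M) = Submodule.span (QS S) (range w) := by
  rw [h, Submodule.span_span_of_tower]

theorem rk_eq {Δ : Submodule (ZS S) (Fin m → QS S)} {v : Fin r → Fin m → ℚ}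
    (hv : LinearIndependent ℚ v)
    (h : Δ = Submodule.span (ZS S) (range fun i => ratVec S m (v i))) : rk Δ = r := by
  rw [rk, span_rat_eq_map h]
  rw [← (Submodule.equivMapOfInjective (ratVec S m) ratVec_injective _).rank_eq, rank_span hv]
  simpa using Cardinal.mk_range_eq v hv.injective

/-- The set of lattice vectors in the rational span of `Δ`. -/
def saturation (Δ : Submodule (ZS S) (Fin m → QS S)) : Submodule (ZS S) (Fin m → QS S) :=
  stdLattice S m ⊓ (Submodule.span ℚ (Δ : Set (Fin m → QS S))).restrictScalars (ZS S)

theorem le_saturation {Δ : Submodule (ZS S) (Fin m → QS S)} (hΔ : Δ ≤ stdLattice S m) :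
    Δ ≤ saturation Δ :=
  le_inf hΔ fun _ hx => Submodule.subset_span hx

theorem span_rat_saturation {Δ : Submodule (ZS S) (Fin m → QS S)} (hΔ : Δ ≤ stdLattice S m) :
    Submodule.span ℚ (saturation Δ : Set (Fin m → QS S)) =
      Submodule.span ℚ (Δ : Set (Fin m → QS S)) :=
  le_antisymm (Submodule.span_le.2 fun _ hx => hx.2) (Submodule.span_mono (le_saturation hΔ))

theorem span_rat_eq_of_le_of_rk_eq {Δ Δ' : Submodule (ZS S) (Fin m → QS S)} (h : Δ ≤ Δ')
    (hΔ' : Δ' ≤ stdLattice S m) (hrk : rk Δ' = rk Δ) :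
    Submodule.span ℚ (Δ : Set (Fin m → QS S)) = Submodule.span ℚ (Δ' : Set (Fin m → QS S)) := by
  obtain ⟨r', v', hv', hs'⟩ := exists_rational_basis hΔ'
  have hfin : Module.Finite ℚ (Submodule.span ℚ (Δ' : Set (Fin m → QS S))) := by
    rw [span_rat_eq_map hs']
    infer_instance
  refine Submodule.eq_of_le_of_finrank_eq (Submodule.span_mono h) ?_
  rw [Module.finrank, Module.finrank]
  exact congrArg _ hrk.symm

theorem isPrimitiveIn_saturation {Δ : Submodule (ZS S) (Fin m → QS S)} (hΔ : Δ ≤ stdLattice S m) :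
    IsPrimitiveIn (saturation Δ) (stdLattice S m) := by
  refine ⟨inf_le_left, fun Δ' h1 h2 hrk => le_antisymm (fun x hx => ⟨h1 hx, ?_⟩) h2⟩
  have := span_rat_eq_of_le_of_rk_eq h2 h1 hrk
  rw [span_rat_saturation hΔ] at this
  change x ∈ Submodule.span ℚ (Δ : Set (Fin m → QS S))
  rw [this]
  exact Submodule.subset_span hx

theorem IsPrimitiveIn.saturation_eq {Δ : Submodule (ZS S) (Fin m → QS S)}
    (h : IsPrimitiveIn Δ (stdLattice S m)) : saturation Δ = Δ :=
  h.2 _ inf_le_left (le_saturation h.1) (by rw [rk, span_rat_saturation h.1, rk])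

theorem IsPrimitiveIn.le_iff_span_le {Δ Δ' : Submodule (ZS S) (Fin m → QS S)}
    (h : Δ ≤ stdLattice S m) (h' : IsPrimitiveIn Δ' (stdLattice S m)) :
    Δ ≤ Δ' ↔ Submodule.span ℚ (Δ : Set (Fin m → QS S)) ≤
      Submodule.span ℚ (Δ' : Set (Fin m → QS S)) := by
  refine ⟨Submodule.span_mono, fun hle x hx => ?_⟩
  rw [← h'.saturation_eq]
  exact ⟨h hx, hle (Submodule.subset_span hx)⟩

/-- A chain of nonzero primitive submodules has at most `m` elements: the ranks are distinct
numbers in `{1, …, m}`. -/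
theorem card_chain_primitive_le (F : Finset (Submodule (ZS S) (Fin m → QS S)))
    (hF : ∀ Δ ∈ F, IsPrimitiveIn Δ (stdLattice S m) ∧ Δ ≠ ⊥)
    (hc : IsChain (· ≤ ·) (F : Set (Submodule (ZS S) (Fin m → QS S)))) : F.card ≤ m := by
  have hrk : ∀ Δ ∈ F, ∃ n ∈ Finset.Icc 1 m, rk Δ = n := by
    intro Δ hΔ
    obtain ⟨r, v, hv, hs⟩ := exists_rational_basis (hF Δ hΔ).1.1
    refine ⟨r, Finset.mem_Icc.2 ⟨?_, ?_⟩, rk_eq hv hs⟩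
    · by_contra! h0
      obtain rfl : r = 0 := by omega
      refine (hF Δ hΔ).2 ?_
      rw [hs]
      simp
    · simpa using hv.fintype_card_le_finrank
  choose! n hn hrk using hrk
  have := Finset.card_le_card_of_injOn n hn (s := F) (t := Finset.Icc 1 m) (by
    intro Δ hΔ Δ' hΔ' heq
    have heq' : rk Δ = rk Δ' := by rw [hrk Δ hΔ, hrk Δ' hΔ', heq]
    rcases hc.total hΔ hΔ' with h | h
    · exact ((hF Δ hΔ).1.2 Δ' (hF Δ' hΔ').1.1 h heq'.symm).symm
    · exact (hF Δ' hΔ').1.2 Δ (hF Δ hΔ).1.1 h heq')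
  simpa using this

end Submodules

/-! ### Components of `ℚ_S`-modules and adapted bases -/

section Components

variable {S : Finset Nat.Primes} {m r : ℕ}

theorem archPart_sum_smul (c : Fin r → QS S) (w : Fin r → Fin m → QS S) :
    archPart (∑ i, c i • w i) = ∑ i, (c i).1 • archPart (w i) := by
  ext j
  simp [archPart, Prod.fst_sum]

theorem padicPart_sum_smul (p : S) (c : Fin r → QS S) (w : Fin r → Fin m → QS S) :
    padicPart p (∑ i, c i • w i) = ∑ i, (c i).2 p • padicPart p (w i) := by
  ext j
  simp [padicPart, Prod.snd_sum]

/-- The vector of `ℚ_S ^ m` with given components. -/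
def ofParts (a : EuclideanSpace ℝ (Fin m))
    (y : (p : S) → Fin m → ℚ_[(p : Nat.Primes)]) : Fin m → QS S :=
  fun j => (a j, fun p => y p j)

@[simp] theorem archPart_ofParts (a : EuclideanSpace ℝ (Fin m))
    (y : (p : S) → Fin m → ℚ_[(p : Nat.Primes)]) : archPart (ofParts a y) = a := rfl

@[simp] theorem padicPart_ofParts (a : EuclideanSpace ℝ (Fin m))
    (y : (p : S) → Fin m → ℚ_[(p : Nat.Primes)]) (p : S) : padicPart p (ofParts a y) = y p := rfl

theorem ext_parts {x y : Fin m → QS S} (h1 : archPart x = archPart y)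
    (h2 : ∀ p, padicPart p x = padicPart p y) : x = y := by
  funext j
  refine Prod.ext ?_ (funext fun p => congrFun (h2 p) j)
  exact congrArg (fun a : EuclideanSpace ℝ (Fin m) => a j) h1

theorem archPart_zero : archPart (0 : Fin m → QS S) = 0 := by
  ext j; simp [archPart]

theorem padicPart_zero (p : S) : padicPart p (0 : Fin m → QS S) = 0 := rfl

theorem mem_span_QS_iff {w : Fin r → Fin m → QS S} {x : Fin m → QS S} :
    x ∈ Submodule.span (QS S) (range w) ↔
      archPart x ∈ Submodule.span ℝ (range fun i => archPart (w i)) ∧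
        ∀ p : S, padicPart p x ∈
          Submodule.span ℚ_[(p : Nat.Primes)] (range fun i => padicPart p (w i)) := by
  simp only [Submodule.mem_span_range_iff_exists_fun]
  constructor
  · rintro ⟨c, rfl⟩
    exact ⟨⟨fun i => (c i).1, (archPart_sum_smul c w).symm⟩,
      fun p => ⟨fun i => (c i).2 p, (padicPart_sum_smul p c w).symm⟩⟩
  · rintro ⟨⟨a, ha⟩, h⟩
    choose y hy using h
    refine ⟨fun i => (a i, fun p => y p i), ext_parts ?_ fun p => ?_⟩
    · rw [archPart_sum_smul]; exact ha
    · rw [padicPart_sum_smul]; exact hy p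

theorem linearIndependent_QS_iff {w : Fin r → Fin m → QS S} :
    LinearIndependent (QS S) w ↔ LinearIndependent ℝ (fun i => archPart (w i)) ∧
      ∀ p : S, LinearIndependent ℚ_[(p : Nat.Primes)] fun i => padicPart p (w i) := by
  simp only [Fintype.linearIndependent_iff]
  constructor
  · intro h
    refine ⟨fun a ha i => ?_, fun p y hy i => ?_⟩
    · refine congrArg Prod.fst (h (fun i => (a i, 0)) (ext_parts ?_ fun p => ?_) i)
      · rw [archPart_sum_smul, archPart_zero]; exact ha
      · rw [padicPart_sum_smul, padicPart_zero]; simp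
    · classical
      have := h (fun i => (0, Pi.single p (y i))) (ext_parts ?_ fun q => ?_) i
      · have h2 := congrFun (congrArg Prod.snd this) p
        simpa using h2
      · rw [archPart_sum_smul, archPart_zero]; simp
      · rw [padicPart_sum_smul, padicPart_zero]
        by_cases hq : q = p
        · subst hq; simpa using hy
        · simp [hq]
  · rintro ⟨h1, h2⟩ c hc i
    refine Prod.ext (h1 (fun i => (c i).1) ?_ i) (funext fun p => h2 p (fun i => (c i).2 p) ?_ i)
    · rw [← archPart_sum_smul, hc, archPart_zero]
    · rw [← padicPart_sum_smul, hc, padicPart_zero]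

theorem coe_linearIndependent_of_basis {L : Submodule (QS S) (Fin m → QS S)}
    (w : Module.Basis (Fin r) (QS S) L) : LinearIndependent (QS S) fun i => (w i : Fin m → QS S) :=
  w.linearIndependent.map' L.subtype (Submodule.ker_subtype L)

theorem span_range_coe_basis {L : Submodule (QS S) (Fin m → QS S)}
    (w : Module.Basis (Fin r) (QS S) L) :
    Submodule.span (QS S) (range fun i => (w i : Fin m → QS S)) = L := by
  have := congrArg (Submodule.map L.subtype) w.span_eq
  rw [Submodule.map_span, ← range_comp, Submodule.map_top, Submodule.range_subtype] at this
  exact this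

theorem exists_basis_of_span_eq {L : Submodule (QS S) (Fin m → QS S)} {b : Fin r → Fin m → QS S}
    (hb : LinearIndependent (QS S) b) (hL : Submodule.span (QS S) (range b) = L) :
    ∃ B : Module.Basis (Fin r) (QS S) L, ∀ i, (B i : Fin m → QS S) = b i := by
  subst hL
  exact ⟨Module.Basis.span hb, fun i => congrArg Subtype.val (Module.Basis.span_apply hb i)⟩

theorem coe_eq_sum_equivFun {L : Submodule (QS S) (Fin m → QS S)}
    (b : Module.Basis (Fin r) (QS S) L) (x : L) :
    (x : Fin m → QS S) = ∑ i, b.equivFun x i • (b i : Fin m → QS S) := by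
  have h := congrArg (Subtype.val) (b.sum_equivFun x)
  rw [Submodule.coe_sum] at h
  exact h.symm

end Components

section Adapted

/-- The integral vectors in an `r`-dimensional subspace of `ℚ_p ^ m` are spanned over `ℤ_p` by a
basis of the subspace. -/
theorem exists_padic_integral_basis {p m r : ℕ} [Fact p.Prime] {w : Fin r → Fin m → ℚ_[p]}
    (hw : LinearIndependent ℚ_[p] w) :
    ∃ y : Fin r → Fin m → ℚ_[p], LinearIndependent ℚ_[p] y ∧
      Submodule.span ℚ_[p] (range y) = Submodule.span ℚ_[p] (range w) ∧
      (Submodule.span ℚ_[p] (range w) : Set (Fin m → ℚ_[p])) ∩ {y | ∀ j, ‖y j‖ ≤ 1} =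
        (Submodule.span ℤ_[p] (range y) : Set (Fin m → ℚ_[p])) := by
  set V := Submodule.span ℚ_[p] (range w) with hV
  let ι : (Fin m → ℤ_[p]) →ₗ[ℤ_[p]] (Fin m → ℚ_[p]) :=
    (Algebra.linearMap ℤ_[p] ℚ_[p]).compLeft (Fin m)
  have hι : ∀ z j, ι z j = (z j : ℚ_[p]) := fun z j => rfl
  have hιinj : Function.Injective ι := fun x y h => funext fun j => Subtype.ext (congrFun h j)
  have hιmem : ∀ x : Fin m → ℚ_[p], (∀ j, ‖x j‖ ≤ 1) → ∃ z, ι z = x :=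
    fun x hx => ⟨fun j => ⟨x j, hx j⟩, rfl⟩
  set N := (V.restrictScalars ℤ_[p]).comap ι with hN
  obtain ⟨n, b⟩ := Submodule.basisOfPid (Pi.basisFun ℤ_[p] (Fin m)) N
  set y : Fin n → Fin m → ℚ_[p] := fun i => ι (b i) with hy
  have hyind : LinearIndependent ℚ_[p] y := by
    rw [← LinearIndependent.iff_fractionRing ℤ_[p] ℚ_[p]]
    exact (b.linearIndependent.map' N.subtype (Submodule.ker_subtype N)).map' ι
      (LinearMap.ker_eq_bot.2 hιinj)
  have hspanZ : Submodule.span ℤ_[p] (range y) = N.map ι := by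
    have h1 := congrArg (Submodule.map (ι ∘ₗ N.subtype)) b.span_eq
    rw [Submodule.map_span, ← range_comp, Submodule.map_top, LinearMap.range_comp,
      Submodule.range_subtype] at h1
    exact h1
  have hint : (V : Set (Fin m → ℚ_[p])) ∩ {y | ∀ j, ‖y j‖ ≤ 1} =
      (Submodule.span ℤ_[p] (range y) : Set (Fin m → ℚ_[p])) := by
    rw [hspanZ]
    ext x
    constructor
    · rintro ⟨hxV, hx⟩
      obtain ⟨z, rfl⟩ := hιmem x hx
      exact ⟨z, hxV, rfl⟩
    · rintro ⟨z, hz, rfl⟩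
      exact ⟨hz, fun j => (z j).2⟩
  have hspanQ : Submodule.span ℚ_[p] (range y) = V := by
    refine le_antisymm (Submodule.span_le.2 ?_) fun x hx => ?_
    · rintro _ ⟨i, rfl⟩
      exact (b i).2
    · obtain ⟨k, hk⟩ := pow_unbounded_of_one_lt ‖x‖
        (by exact_mod_cast (Fact.out : p.Prime).one_lt : (1 : ℝ) < (p : ℝ))
      have hp0 : (p : ℚ_[p]) ≠ 0 := by exact_mod_cast (Fact.out : p.Prime).ne_zero
      have hpR : (0 : ℝ) < p := by exact_mod_cast (Fact.out : p.Prime).pos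
      have hmem : (p : ℚ_[p]) ^ k • x ∈ (V : Set (Fin m → ℚ_[p])) ∩ {y | ∀ j, ‖y j‖ ≤ 1} := by
        refine ⟨V.smul_mem _ hx, fun j => ?_⟩
        rw [Pi.smul_apply, norm_smul, norm_pow, Padic.norm_p, inv_pow]
        rw [inv_mul_le_one₀ (by positivity)]
        exact (norm_le_pi_norm x j).trans hk.le
      rw [hint] at hmem
      have h1 := Submodule.span_le_restrictScalars ℤ_[p] ℚ_[p] (range y) hmem
      have h2 := (Submodule.span ℚ_[p] (range y)).smul_mem ((p : ℚ_[p]) ^ k)⁻¹ h1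
      rwa [smul_smul, inv_mul_cancel₀ (pow_ne_zero _ hp0), one_smul] at h2
  have hn : n = r := by
    have h1 := finrank_span_eq_card hyind
    have h2 := finrank_span_eq_card hw
    rw [hspanQ] at h1
    simpa using h1.symm.trans h2
  subst hn
  exact ⟨y, hyind, hspanQ, hint⟩

variable {S : Finset Nat.Primes} {m r : ℕ}

/-- Every free submodule with a finite basis has an adapted basis. -/
theorem exists_isAdapted {L : Submodule (QS S) (Fin m → QS S)} (w : Module.Basis (Fin r) (QS S) L) :
    ∃ b : Module.Basis (Fin r) (QS S) L, IsAdapted b := by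
  have hw := linearIndependent_QS_iff.1 (coe_linearIndependent_of_basis w)
  have hL : ∀ x, x ∈ L ↔
      archPart x ∈ Submodule.span ℝ (range fun i => archPart (w i : Fin m → QS S)) ∧
        ∀ p : S, padicPart p x ∈ Submodule.span ℚ_[(p : Nat.Primes)]
          (range fun i => padicPart p (w i : Fin m → QS S)) := fun x => by
    rw [← mem_span_QS_iff, span_range_coe_basis w]
  -- Gram–Schmidt at the infinite place, and a basis of the integral vectors at the finite ones
  set a := InnerProductSpace.gramSchmidtNormed ℝ fun i => archPart (w i : Fin m → QS S) with ha
  have haon : Orthonormal ℝ a := InnerProductSpace.gramSchmidtNormed_orthonormal hw.1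
  have haspan : Submodule.span ℝ (range a) =
      Submodule.span ℝ (range fun i => archPart (w i : Fin m → QS S)) := by
    rw [ha, InnerProductSpace.span_gramSchmidtNormed_range, InnerProductSpace.span_gramSchmidt]
  choose y hyind hyspan hyint using fun p => exists_padic_integral_basis (hw.2 p)
  set b : Fin r → Fin m → QS S := fun i => ofParts (a i) fun p => y p i with hb
  have hbind : LinearIndependent (QS S) b :=
    linearIndependent_QS_iff.2 ⟨haon.linearIndependent, hyind⟩
  have hbspan : Submodule.span (QS S) (range b) = L := by
    ext x
    rw [mem_span_QS_iff, hL]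
    simp only [hb, archPart_ofParts, padicPart_ofParts]
    rw [haspan]
    simp only [hyspan]
  obtain ⟨B, hB⟩ := exists_basis_of_span_eq hbind hbspan
  refine ⟨B, ?_, fun p => ?_⟩
  · simpa only [hB, hb, archPart_ofParts] using haon
  · have h1 : padicPart p '' (L : Set (Fin m → QS S)) =
        (Submodule.span ℚ_[(p : Nat.Primes)]
          (range fun i => padicPart p (w i : Fin m → QS S)) : Set _) := by
      ext z
      constructor
      · rintro ⟨x, hx, rfl⟩
        exact ((hL x).1 hx).2 p
      · intro hz
        classical
        refine ⟨ofParts 0 (Function.update 0 p z), (hL _).2 ⟨?_, fun q => ?_⟩, ?_⟩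
        · simp
        · by_cases hq : q = p
          · subst hq; simpa using hz
          · simp [hq]
        · simp
    rw [h1, hyint p]
    simp [hB, hb]

/-- The coordinates with respect to an adapted basis have at most the content of the vector. -/
theorem IsAdapted.content_equivFun_le {L : Submodule (QS S) (Fin m → QS S)}
    {b : Module.Basis (Fin r) (QS S) L} (hb : IsAdapted b) (x : L) :
    content (b.equivFun x) ≤ content (x : Fin m → QS S) := by
  have hx : (x : Fin m → QS S) = ∑ i, b.equivFun x i • (b i : Fin m → QS S) :=
    coe_eq_sum_equivFun b x
  set t := b.equivFun x
  have hind := linearIndependent_QS_iff.1 (coe_linearIndependent_of_basis b)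
  have harch : ‖archPart t‖ = ‖archPart (x : Fin m → QS S)‖ := by
    rw [← sq_eq_sq₀ (norm_nonneg _) (norm_nonneg _), hx, archPart_sum_smul, norm_archPart_sq,
      ← real_inner_self_eq_norm_sq, hb.orthonormal.inner_sum]
    simp [pow_two]
  have hpadic : ∀ p, ‖padicPart p t‖ ≤ ‖padicPart p (x : Fin m → QS S)‖ := by
    intro p
    have hsum : padicPart p (x : Fin m → QS S) =
        ∑ i, (t i).2 p • padicPart p (b i : Fin m → QS S) := by
      rw [hx, padicPart_sum_smul]
    rcases isEmpty_or_nonempty (Fin m) with hm | hm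
    · have h0 : padicPart p (x : Fin m → QS S) = 0 := Subsingleton.elim _ _
      have h1 := Fintype.linearIndependent_iff.1 (hind.2 p) _ (hsum.symm.trans h0)
      have h2 : padicPart p t = 0 := funext h1
      rw [h2, norm_zero]
      exact norm_nonneg _
    obtain ⟨j, hj⟩ := Finite.exists_max fun j => ‖padicPart p (x : Fin m → QS S) j‖
    set d := padicPart p (x : Fin m → QS S) j with hd
    have hxd : ‖padicPart p (x : Fin m → QS S)‖ = ‖d‖ :=
      le_antisymm ((pi_norm_le_iff_of_nonneg (norm_nonneg _)).2 hj)
        (norm_le_pi_norm (padicPart p (x : Fin m → QS S)) j)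
    by_cases hd0 : d = 0
    · have h0 : padicPart p (x : Fin m → QS S) = 0 := by
        rw [← norm_eq_zero, hxd, hd0, norm_zero]
      have h1 := Fintype.linearIndependent_iff.1 (hind.2 p) _ (hsum.symm.trans h0)
      have h2 : padicPart p t = 0 := funext h1
      rw [h2, norm_zero]
      exact norm_nonneg _
    -- after division by `d` the `p`-adic component is integral
    have hmem : d⁻¹ • padicPart p (x : Fin m → QS S) ∈
        padicPart p '' (L : Set (Fin m → QS S)) ∩ {y | ∀ j, ‖y j‖ ≤ 1} := by
      refine ⟨⟨((0, Function.update 0 p d⁻¹) : QS S) •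
        (x : Fin m → QS S), L.smul_mem _ x.2, ?_⟩, fun i => ?_⟩
      · funext i
        simp [padicPart]
      · rw [Pi.smul_apply, norm_smul, norm_inv, inv_mul_le_one₀ (norm_pos_iff.2 hd0)]
        exact hj i
    rw [hb.integral p, SetLike.mem_coe, Submodule.mem_span_range_iff_exists_fun] at hmem
    obtain ⟨z, hz⟩ := hmem
    have hcoef : ∀ i, (t i).2 p = d * z i := by
      intro i
      have h1 : ∑ i, ((t i).2 p - d * z i) • padicPart p (b i : Fin m → QS S) = 0 := by
        have h2 : padicPart p (x : Fin m → QS S) =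
            ∑ i, (d * z i : ℚ_[(p : Nat.Primes)]) • padicPart p (b i : Fin m → QS S) := by
          have h3 := congrArg (fun v => d • v) hz
          simp only [smul_smul, mul_inv_cancel₀ hd0, one_smul, Finset.smul_sum] at h3
          rw [← h3]
          refine Finset.sum_congr rfl fun i _ => ?_
          rw [mul_smul]
          rfl
        simp only [sub_smul, Finset.sum_sub_distrib]
        rw [← hsum, ← h2, sub_self]
      exact sub_eq_zero.1 (Fintype.linearIndependent_iff.1 (hind.2 p) _ h1 i)
    rw [hxd, pi_norm_le_iff_of_nonneg (norm_nonneg _)]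
    intro i
    change ‖(t i).2 p‖ ≤ ‖d‖
    rw [hcoef, norm_mul]
    exact mul_le_of_le_one_right (norm_nonneg _) (z i).2
  unfold content
  rw [harch]
  gcongr with p
  exact hpadic p

theorem IsAdapted.content_basis_le_one {L : Submodule (QS S) (Fin m → QS S)}
    {b : Module.Basis (Fin r) (QS S) L} (hb : IsAdapted b) (i : Fin r) :
    content (b i : Fin m → QS S) ≤ 1 := by
  rw [content, hb.orthonormal.1 i, one_mul]
  refine Finset.prod_le_one (fun _ _ => norm_nonneg _) fun p _ => ?_
  have h1 : padicPart p (b i : Fin m → QS S) ∈ (Submodule.span ℤ_[(p : Nat.Primes)]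
      (range fun i => padicPart p (b i : Fin m → QS S)) : Set _) :=
    Submodule.subset_span ⟨i, rfl⟩
  rw [← hb.integral p] at h1
  exact (pi_norm_le_iff_of_nonneg zero_le_one).2 h1.2

end Adapted

/-! ### The covolume of a lattice with a given basis -/

section

open scoped NNReal

section Covolume

variable {S : Finset Nat.Primes} {m r : ℕ} {L : Submodule (QS S) (Fin m → QS S)}

/-- By the Lusin–Souslin theorem, as `ℚ_S ^ r` is Polish. -/
theorem measurableEmbedding_equivFun_symm (b : Module.Basis (Fin r) (QS S) L) :
    MeasurableEmbedding (b.equivFun.symm : (Fin r → QS S) → L) := by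
  refine Continuous.measurableEmbedding ?_ b.equivFun.symm.injective
  exact b.equivFun.symm.toLinearMap.continuous_on_pi

/-- The normalized volume is the image of the Haar measure of `ℚ_S ^ r` under the linear map that is
given by some adapted basis. -/
theorem exists_volumeOn_eq (w : Module.Basis (Fin r) (QS S) L) :
    ∃ b : Module.Basis (Fin r) (QS S) L, IsAdapted b ∧
      volumeOn L = (Measure.pi fun _ : Fin r => haarQS S).map b.equivFun.symm := by
  have H : ∃ b : (Σ r : ℕ, Module.Basis (Fin r) (QS S) L), IsAdapted b.2 := by
    obtain ⟨b, hb⟩ := exists_isAdapted w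
    exact ⟨⟨r, b⟩, hb⟩
  have hvol : volumeOn L =
      (Measure.pi fun _ : Fin H.choose.1 => haarQS S).map H.choose.2.equivFun.symm := by
    rw [volumeOn, dif_pos H]
    congr 1
    funext c
    exact (H.choose.2.equivFun_symm_apply c).symm
  have hb := H.choose_spec
  revert hvol hb
  generalize H.choose = B
  intro hvol hb
  obtain ⟨r', b⟩ := B
  obtain rfl : r = r' := by simpa using Fintype.card_congr (w.indexEquiv b)
  exact ⟨b, hb, hvol⟩

/-- The points whose coordinates, with respect to a basis `w`, lie in the unit cell: a fundamental
domain for the `ℤ_S`-span of `w`. -/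
def cell (w : Module.Basis (Fin r) (QS S) L) : Set L := {x | ∀ i, w.equivFun x i ∈ unitCell S}

/-- The normalized volume of the fundamental domain that is spanned by a basis `w`. -/
def cellVol (w : Module.Basis (Fin r) (QS S) L) : ℝ≥0∞ := volumeOn L (cell w)

theorem cell_eq_image (w : Module.Basis (Fin r) (QS S) L) :
    cell w = w.equivFun.symm '' unitCube S r := by
  ext x
  constructor
  · intro hx
    exact ⟨w.equivFun x, fun i _ => hx i, w.equivFun.symm_apply_apply x⟩
  · rintro ⟨y, hy, rfl⟩ i
    rw [LinearEquiv.apply_symm_apply]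
    exact hy i trivial

theorem measurableSet_cell (w : Module.Basis (Fin r) (QS S) L) : MeasurableSet (cell w) := by
  rw [cell_eq_image]
  exact (measurableEmbedding_equivFun_symm w).measurableSet_image.2 (measurableSet_unitCube S r)

theorem map_equivFun_symm_cell (b w : Module.Basis (Fin r) (QS S) L) :
    (Measure.pi fun _ : Fin r => haarQS S).map b.equivFun.symm (cell w) =
      linScale (w.equivFun.symm ≪≫ₗ b.equivFun) := by
  rw [(measurableEmbedding_equivFun_symm b).map_apply, linScale_eq, cell_eq_image]
  congr 1
  ext y
  constructor
  · rintro ⟨z, hz, hzy⟩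
    refine ⟨z, hz, ?_⟩
    rw [LinearEquiv.trans_apply, hzy]
    exact b.equivFun.apply_symm_apply y
  · rintro ⟨z, hz, rfl⟩
    exact ⟨z, hz, by simp⟩

/-- A change of basis multiplies the volume of the cell by the scaling factor of the transition
matrix. -/
theorem cellVol_eq_mul (c w : Module.Basis (Fin r) (QS S) L) :
    cellVol w = linScale (w.equivFun.symm ≪≫ₗ c.equivFun) * cellVol c := by
  obtain ⟨b, -, hvol⟩ := exists_volumeOn_eq w
  have h : w.equivFun.symm ≪≫ₗ b.equivFun =
      (w.equivFun.symm ≪≫ₗ c.equivFun).trans (c.equivFun.symm ≪≫ₗ b.equivFun) := by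
    ext1 x; simp
  rw [cellVol, cellVol, hvol, map_equivFun_symm_cell, map_equivFun_symm_cell, h, linScale_trans,
    ENNReal.coe_mul]

theorem cellVol_ne_top (w : Module.Basis (Fin r) (QS S) L) : cellVol w ≠ ∞ := by
  obtain ⟨b, -, hvol⟩ := exists_volumeOn_eq w
  rw [cellVol, hvol, map_equivFun_symm_cell]
  exact ENNReal.coe_ne_top

theorem archPart_ne_zero_of_injective {f : (Fin r → QS S) →ₗ[QS S] (Fin m → QS S)}
    (hf : Function.Injective f) (i : Fin r) : archPart (f (Pi.single i 1)) ≠ 0 := by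
  intro h
  have h1 : f (Pi.single i ((1, 0) : QS S)) = 0 := by
    have h2 : (Pi.single i ((1, 0) : QS S) : Fin r → QS S) = ((1, 0) : QS S) • Pi.single i 1 := by
      rw [← Pi.single_smul, smul_eq_mul, mul_one]
    rw [h2, map_smul]
    refine ext_parts ?_ fun p => ?_
    · ext j
      have := congrArg (fun a : EuclideanSpace ℝ (Fin m) => a j) h
      simpa [archPart] using this
    · funext j
      simp [padicPart]
  have h3 := congrFun ((map_eq_zero_iff f hf).1 h1) i
  rw [Pi.single_eq_same] at h3
  exact one_ne_zero (congrArg Prod.fst h3)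

theorem padicPart_ne_zero_of_injective {f : (Fin r → QS S) →ₗ[QS S] (Fin m → QS S)}
    (hf : Function.Injective f) (i : Fin r) (p : S) : padicPart p (f (Pi.single i 1)) ≠ 0 := by
  classical
  intro h
  have h1 : f (Pi.single i ((0, Pi.single p 1) : QS S)) = 0 := by
    have h2 : (Pi.single i ((0, Pi.single p 1) : QS S) : Fin r → QS S) =
        ((0, Pi.single p 1) : QS S) • Pi.single i 1 := by
      rw [← Pi.single_smul, smul_eq_mul, mul_one]
    rw [h2, map_smul]
    refine ext_parts ?_ fun q => ?_
    · ext j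
      simp [archPart]
    · funext j
      by_cases hq : q = p
      · subst hq
        have := congrFun h j
        simpa [padicPart] using this
      · simp [padicPart, hq]
  have h3 := congrFun ((map_eq_zero_iff f hf).1 h1) i
  rw [Pi.single_eq_same] at h3
  have h4 := congrFun (congrArg Prod.snd h3) p
  have h5 : (1 : ℚ_[(p : Nat.Primes)]) = 0 := by simp at h4
  exact one_ne_zero h5

/-- The volume of the cell is at most the product of the contents of the basis vectors. -/
theorem cellVol_le_prod_content (w : Module.Basis (Fin r) (QS S) L) :
    cellVol w ≤ ENNReal.ofReal (∏ i, content (w i : Fin m → QS S)) := by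
  obtain ⟨b, hb, hvol⟩ := exists_volumeOn_eq w
  rw [cellVol, hvol, map_equivFun_symm_cell]
  set e := w.equivFun.symm ≪≫ₗ b.equivFun with he
  have hcol : ∀ i, e (Pi.single i 1) = b.equivFun (w i) := by
    intro i
    simp [he, Module.Basis.equivFun_symm_apply]
  have hinj : Function.Injective e.toLinearMap := e.injective
  refine (linScale_le_prod_content e (archPart_ne_zero_of_injective hinj)
    fun i p => padicPart_ne_zero_of_injective hinj i p).trans (ENNReal.ofReal_le_ofReal ?_)
  refine Finset.prod_le_prod (fun i _ => by unfold content; positivity) fun i _ => ?_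
  rw [hcol]
  exact hb.content_equivFun_le (w i)

theorem volumeOn_isAddLeftInvariant (w : Module.Basis (Fin r) (QS S) L) :
    (volumeOn L).IsAddLeftInvariant := by
  obtain ⟨b, -, hvol⟩ := exists_volumeOn_eq w
  rw [hvol]
  exact isAddLeftInvariant_map (b.equivFun.symm : (Fin r → QS S) →ₗ[QS S] L).toAddHom
    (measurableEmbedding_equivFun_symm b).measurable b.equivFun.symm.surjective

theorem vaddInvariantMeasure_volumeOn (w : Module.Basis (Fin r) (QS S) L) (Γ : AddSubgroup L) :
    VAddInvariantMeasure Γ L (volumeOn L) := by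
  have := volumeOn_isAddLeftInvariant w
  exact ⟨fun g s _ => measure_preimage_add (volumeOn L) (g : L) s⟩

/-- The lattice in `L` with basis `w`. -/
def basisLattice (w : Module.Basis (Fin r) (QS S) L) : AddSubgroup L :=
  (Submodule.span (ZS S) (range fun i => (w i : Fin m → QS S))).toAddSubgroup.comap
    L.subtype.toAddMonoidHom

theorem mem_basisLattice {w : Module.Basis (Fin r) (QS S) L} {x : L} :
    x ∈ basisLattice w ↔ ∃ γ : Fin r → ZS S, ∀ i,
      w.equivFun x i = algebraMap (ZS S) (QS S) (γ i) := by
  have h1 : x ∈ basisLattice w ↔ (x : Fin m → QS S) ∈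
      Submodule.span (ZS S) (range fun i => (w i : Fin m → QS S)) := Iff.rfl
  rw [h1, Submodule.mem_span_range_iff_exists_fun]
  refine exists_congr fun γ => ?_
  have h2 : ∑ i, γ i • (w i : Fin m → QS S) =
      (w.equivFun.symm fun i => algebraMap (ZS S) (QS S) (γ i) : L) := by
    rw [Module.Basis.equivFun_symm_apply, Submodule.coe_sum]
    refine Finset.sum_congr rfl fun i _ => ?_
    rw [Submodule.coe_smul, algebraMap_smul]
  rw [h2]
  constructor
  · intro h i
    rw [← Subtype.ext h, LinearEquiv.apply_symm_apply]
  · intro h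
    rw [← funext h, LinearEquiv.symm_apply_apply]

theorem countable_basisLattice (w : Module.Basis (Fin r) (QS S) L) :
    Countable (basisLattice w) := by
  choose γ hγ using fun x : basisLattice w => mem_basisLattice.1 x.2
  refine Function.Injective.countable (f := γ) fun x y hxy => ?_
  apply Subtype.ext
  apply w.equivFun.injective
  funext i
  rw [hγ, hγ, hxy]

theorem isAddFundamentalDomain_cell (w : Module.Basis (Fin r) (QS S) L) (ν : Measure L) :
    IsAddFundamentalDomain (basisLattice w) (cell w) ν := by
  refine IsAddFundamentalDomain.mk' (measurableSet_cell w).nullMeasurableSet fun x => ?_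
  choose γ hγ huniq using fun i => existsUnique_add_mem_unitCell (w.equivFun x i)
  simp only at hγ huniq
  refine ⟨⟨w.equivFun.symm fun i => algebraMap (ZS S) (QS S) (γ i),
    mem_basisLattice.2 ⟨γ, fun i => by rw [LinearEquiv.apply_symm_apply]⟩⟩,
    fun i => ?_, fun g hg => ?_⟩
  · rw [AddSubgroup.vadd_def, vadd_eq_add, map_add, LinearEquiv.apply_symm_apply]
    exact hγ i
  · obtain ⟨γ', hγ'⟩ := mem_basisLattice.1 g.2
    apply Subtype.ext
    apply w.equivFun.injective
    funext i
    rw [LinearEquiv.apply_symm_apply, hγ', huniq i (γ' i)]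
    have := hg i
    rwa [AddSubgroup.vadd_def, vadd_eq_add, map_add, Pi.add_apply, hγ'] at this

theorem addCovolume_basisLattice (w : Module.Basis (Fin r) (QS S) L) :
    addCovolume (basisLattice w) L (volumeOn L) = cellVol w := by
  have := countable_basisLattice w
  have := vaddInvariantMeasure_volumeOn w (basisLattice w)
  exact (isAddFundamentalDomain_cell w (volumeOn L)).covolume_eq_volume _

theorem cov_eq_toReal_cellVol {Δ : Submodule (ZS S) (Fin m → QS S)}
    (hL : Submodule.span (QS S) (Δ : Set (Fin m → QS S)) = L) (w : Module.Basis (Fin r) (QS S) L)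
    (hw : Δ = Submodule.span (ZS S) (range fun i => (w i : Fin m → QS S))) :
    cov Δ = (cellVol w).toReal := by
  subst hL
  rw [← addCovolume_basisLattice, cov, basisLattice, ← hw]

/-- A sublattice has a larger covolume. -/
theorem cellVol_le_of_basisLattice_le {r' : ℕ} {w : Module.Basis (Fin r) (QS S) L}
    {w' : Module.Basis (Fin r') (QS S) L} (h : basisLattice w ≤ basisLattice w') :
    cellVol w' ≤ cellVol w := by
  have := countable_basisLattice w
  have := vaddInvariantMeasure_volumeOn w (basisLattice w)
  refine (isAddFundamentalDomain_cell w (volumeOn L)).measure_le_of_pairwise_disjoint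
    (measurableSet_cell w').nullMeasurableSet fun g g' hgg' => ?_
  have hd := (isAddFundamentalDomain_cell w' (volumeOn L)).aedisjoint
    (i := ⟨g, h g.2⟩) (j := ⟨g', h g'.2⟩) 
    fun heq => hgg' (Subtype.ext (congrArg (fun x : basisLattice w' => (x : L)) heq))
  exact hd.mono inter_subset_left inter_subset_left

theorem cov_nonneg (Δ : Submodule (ZS S) (Fin m → QS S)) : 0 ≤ cov Δ := ENNReal.toReal_nonneg

end Covolume

end

/-! ### Inequalities between covolumes -/

section

open scoped NNReal

section Inequalities

variable {S : Finset Nat.Primes} {m r : ℕ} {L : Submodule (QS S) (Fin m → QS S)}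

/-- The identity on a first coordinate, and a linear automorphism on the others. -/
def consEquiv (e : (Fin r → QS S) ≃ₗ[QS S] (Fin r → QS S)) :
    (Fin (r + 1) → QS S) ≃ₗ[QS S] (Fin (r + 1) → QS S) where
  toFun y := Fin.cons (y 0) (e (Fin.tail y))
  map_add' x y := by
    funext i
    refine Fin.cases rfl (fun j => ?_) i
    exact congrFun (map_add e (Fin.tail x) (Fin.tail y)) j
  map_smul' c x := by
    funext i
    refine Fin.cases rfl (fun j => ?_) i
    exact congrFun (map_smul e c (Fin.tail x)) j
  invFun y := Fin.cons (y 0) (e.symm (Fin.tail y))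
  left_inv y := by simp
  right_inv y := by simp

theorem consEquiv_symm_cons (e : (Fin r → QS S) ≃ₗ[QS S] (Fin r → QS S)) (a : QS S)
    (t : Fin r → QS S) :
    (consEquiv e).symm (Fin.cons a t : Fin (r + 1) → QS S) = Fin.cons a (e.symm t) := rfl

theorem single_zero_eq_cons :
    (Pi.single 0 1 : Fin (r + 1) → QS S) = Fin.cons 1 (0 : Fin r → QS S) := by
  funext i
  refine Fin.cases ?_ (fun j => ?_) i
  · rw [Pi.single_eq_same, Fin.cons_zero]
  · rw [Pi.single_eq_of_ne (Fin.succ_ne_zero j), Fin.cons_succ, Pi.zero_apply]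

theorem single_succ_eq_cons (j : Fin r) :
    (Pi.single j.succ 1 : Fin (r + 1) → QS S) = Fin.cons 0 (Pi.single j 1 : Fin r → QS S) := by
  funext i
  refine Fin.cases ?_ (fun k => ?_) i
  · rw [Pi.single_eq_of_ne (Fin.succ_ne_zero j).symm, Fin.cons_zero]
  · by_cases h : k = j
    · subst h
      rw [Pi.single_eq_same, Fin.cons_succ, Pi.single_eq_same]
    · rw [Pi.single_eq_of_ne fun h' => h (Fin.succ_injective r h'), Fin.cons_succ,
        Pi.single_eq_of_ne h]

theorem content_nonneg (x : Fin m → QS S) : 0 ≤ content x := by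
  unfold content; positivity

/-- Adding a vector to a basis multiplies the volume of the cell by at most the content of the
vector. -/
theorem cellVol_cons_le {L' : Submodule (QS S) (Fin m → QS S)} (w : Module.Basis (Fin r) (QS S) L)
    (w' : Module.Basis (Fin (r + 1)) (QS S) L')
    (hw : ∀ i : Fin r, (w' i.succ : Fin m → QS S) = w i) :
    cellVol w' ≤ cellVol w * ENNReal.ofReal (content (w' 0 : Fin m → QS S)) := by
  obtain ⟨b, hb, hvol⟩ := exists_volumeOn_eq w
  set e := w.equivFun.symm ≪≫ₗ b.equivFun with he
  have hcell : cellVol w = linScale e := by rw [cellVol, hvol, map_equivFun_symm_cell]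
  -- the basis of `L'` that consists of the new vector and of the adapted basis of `L`
  set c : Module.Basis (Fin (r + 1)) (QS S) L' :=
    Module.Basis.ofEquivFun (w'.equivFun ≪≫ₗ consEquiv e) with hc
  have hsum : ∀ (a : QS S) (t : Fin r → QS S),
      ((w'.equivFun.symm (Fin.cons a t) : L') : Fin m → QS S) =
        a • (w' 0 : Fin m → QS S) + (w.equivFun.symm t : L) := by
    intro a t
    rw [Module.Basis.equivFun_symm_apply, Module.Basis.equivFun_symm_apply, Fin.sum_univ_succ,
      Submodule.coe_add, Submodule.coe_sum, Submodule.coe_sum]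
    refine congrArg₂ _ rfl (Finset.sum_congr rfl fun i _ => ?_)
    rw [Submodule.coe_smul, Submodule.coe_smul, hw, Fin.cons_succ]
  have hci : ∀ i, c i = w'.equivFun.symm ((consEquiv e).symm (Pi.single i 1)) := by
    intro i
    rw [hc, Module.Basis.coe_ofEquivFun]
    rfl
  have hc0 : (c 0 : Fin m → QS S) = w' 0 := by
    rw [hci, single_zero_eq_cons, consEquiv_symm_cons, hsum, map_zero e.symm,
      map_zero w.equivFun.symm, one_smul,
      Submodule.coe_zero, add_zero]
  have hcs : ∀ j : Fin r, (c j.succ : Fin m → QS S) = b j := by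
    intro j
    rw [hci, single_succ_eq_cons, consEquiv_symm_cons, hsum, zero_smul, zero_add]
    change ((w.equivFun.symm (w.equivFun (b.equivFun.symm (Pi.single j 1))) : L) : Fin m → QS S) = _
    rw [LinearEquiv.symm_apply_apply]
    simp [Module.Basis.equivFun_symm_apply]
  have hscale : linScale (w'.equivFun.symm ≪≫ₗ c.equivFun) = linScale e := by
    refine linScale_cons _ _ fun y => ?_
    rw [hc, Module.Basis.equivFun_ofEquivFun, LinearEquiv.trans_apply, LinearEquiv.trans_apply,
      LinearEquiv.apply_symm_apply]
    rfl
  rw [cellVol_eq_mul c w', hscale, hcell]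
  gcongr
  refine (cellVol_le_prod_content c).trans (ENNReal.ofReal_le_ofReal ?_)
  rw [Fin.prod_univ_succ, hc0]
  refine mul_le_of_le_one_right (content_nonneg _) ?_
  refine Finset.prod_le_one (fun _ _ => content_nonneg _) fun i _ => ?_
  rw [hcs]
  exact hb.content_basis_le_one i

theorem mulVecLin_injective (g : Matrix.GeneralLinearGroup (Fin m) (QS S)) :
    Function.Injective (Matrix.mulVecLin (g : Matrix (Fin m) (Fin m) (QS S))) := by
  intro x y h
  have h1 := congrArg (Matrix.mulVec ((g⁻¹ : Matrix.GeneralLinearGroup (Fin m) (QS S)) :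
    Matrix (Fin m) (Fin m) (QS S))) h
  simpa [Matrix.mulVecLin_apply, Matrix.mulVec_mulVec] using h1

theorem glMap_span_range {ι : Type*} (g : Matrix.GeneralLinearGroup (Fin m) (QS S))
    (w : ι → Fin m → QS S) :
    glMap g (Submodule.span (ZS S) (range w)) =
      Submodule.span (ZS S) (range fun i => (g : Matrix (Fin m) (Fin m) (QS S)).mulVec (w i)) := by
  rw [glMap, Submodule.map_span, ← range_comp]
  rfl

theorem glMap_glMap (k g : Matrix.GeneralLinearGroup (Fin m) (QS S))
    (Δ : Submodule (ZS S) (Fin m → QS S)) : glMap k (glMap g Δ) = glMap (k * g) Δ := by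
  ext x
  simp only [glMap, Submodule.mem_map, LinearMap.restrictScalars_apply, Matrix.mulVecLin_apply]
  constructor
  · rintro ⟨_, ⟨y, hy, rfl⟩, rfl⟩
    exact ⟨y, hy, by rw [Matrix.mulVec_mulVec]; rfl⟩
  · rintro ⟨y, hy, rfl⟩
    exact ⟨_, ⟨y, hy, rfl⟩, by rw [Matrix.mulVec_mulVec]; rfl⟩

theorem span_QS_glMap (g : Matrix.GeneralLinearGroup (Fin m) (QS S))
    (Δ : Submodule (ZS S) (Fin m → QS S)) :
    Submodule.span (QS S) (glMap g Δ : Set (Fin m → QS S)) =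
      (Submodule.span (QS S) (Δ : Set (Fin m → QS S))).map
        (Matrix.mulVecLin (g : Matrix (Fin m) (Fin m) (QS S))) := by
  rw [Submodule.map_span]
  rfl

/-- The covolume of `k Δ`, for variable `k`, is at most the covolume of `Δ` times the product of the
contents of the images of finitely many vectors of content at most one. -/
theorem exists_cov_glMap_le {Δ : Submodule (ZS S) (Fin m → QS S)}
    (hL : Submodule.span (QS S) (Δ : Set (Fin m → QS S)) = L) (w : Module.Basis (Fin r) (QS S) L)
    (hw : Δ = Submodule.span (ZS S) (range fun i => (w i : Fin m → QS S))) :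
    ∃ b : Fin r → Fin m → QS S, (∀ i, content (b i) ≤ 1) ∧
      ∀ k : Matrix.GeneralLinearGroup (Fin m) (QS S), cov (glMap k Δ) ≤
        cov Δ * ∏ i, content ((k : Matrix (Fin m) (Fin m) (QS S)).mulVec (b i)) := by
  obtain ⟨b, hb, hvol⟩ := exists_volumeOn_eq w
  refine ⟨fun i => b i, hb.content_basis_le_one, fun k => ?_⟩
  set f := Submodule.equivMapOfInjective (Matrix.mulVecLin (k : Matrix (Fin m) (Fin m) (QS S)))
    (mulVecLin_injective k) L with hf
  have hcov : cov (glMap k Δ) = (cellVol (w.map f)).toReal := by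
    refine cov_eq_toReal_cellVol ?_ _ ?_
    · rw [span_QS_glMap, hL]
    · rw [hw, glMap_span_range]
      simp [hf]
  have hscale : (w.map f).equivFun.symm ≪≫ₗ (b.map f).equivFun =
      w.equivFun.symm ≪≫ₗ b.equivFun := by
    apply LinearEquiv.ext
    intro y
    rw [Module.Basis.map_equivFun, Module.Basis.map_equivFun]
    change b.equivFun (f.symm (f (w.equivFun.symm y))) = b.equivFun (w.equivFun.symm y)
    rw [LinearEquiv.symm_apply_apply]
  rw [hcov, cov_eq_toReal_cellVol hL w hw, cellVol_eq_mul (b.map f), hscale,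
    show cellVol w = linScale (w.equivFun.symm ≪≫ₗ b.equivFun) by
      rw [cellVol, hvol, map_equivFun_symm_cell], ENNReal.toReal_mul]
  gcongr
  refine ENNReal.toReal_le_of_le_ofReal (Finset.prod_nonneg fun _ _ => content_nonneg _) ?_
  refine (cellVol_le_prod_content _).trans (le_of_eq ?_)
  simp [hf]

theorem exists_basis_glMap (g : Matrix.GeneralLinearGroup (Fin m) (QS S)) {v : Fin r → Fin m → ℚ}
    (hv : LinearIndependent ℚ v) {Δ : Submodule (ZS S) (Fin m → QS S)}
    (hΔ : Δ = Submodule.span (ZS S) (range fun i => ratVec S m (v i)))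
    (hL : Submodule.span (QS S) (glMap g Δ : Set (Fin m → QS S)) = L) :
    ∃ w : Module.Basis (Fin r) (QS S) L,
      (∀ i, (w i : Fin m → QS S) =
        (g : Matrix (Fin m) (Fin m) (QS S)).mulVec (ratVec S m (v i))) ∧
      glMap g Δ = Submodule.span (ZS S) (range fun i => (w i : Fin m → QS S)) := by
  have hspan : glMap g Δ = Submodule.span (ZS S) (range fun i =>
      (g : Matrix (Fin m) (Fin m) (QS S)).mulVec (ratVec S m (v i))) := by
    rw [hΔ, glMap_span_range]
  obtain ⟨w, hw⟩ := exists_basis_of_span_eq (L := L)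
    ((linearIndependent_ratVec hv).map' _ (LinearMap.ker_eq_bot.2 (mulVecLin_injective g)))
    (by rw [← hL, span_QS_eq hspan]; rfl)
  refine ⟨w, hw, ?_⟩
  simp only [hw]
  exact hspan

theorem continuous_content : Continuous (content : (Fin m → QS S) → ℝ) := by
  unfold content
  refine Continuous.mul ?_ (continuous_finsetProd _ fun p _ => ?_)
  · refine (Continuous.norm ?_)
    unfold archPart
    exact (PiLp.continuous_toLp 2 _).comp (by fun_prop)
  · refine Continuous.norm ?_
    unfold padicPart
    fun_prop

/-- The covolume of `g Δ` is an upper semicontinuous function of `g`. -/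
theorem upperSemicontinuousAt_cov_glMap {Δ : Submodule (ZS S) (Fin m → QS S)}
    (hΔ : Δ ≤ stdLattice S m) (g₀ : Matrix.GeneralLinearGroup (Fin m) (QS S)) :
    UpperSemicontinuousAt (fun g => cov (glMap g Δ)) g₀ := by
  obtain ⟨r, v, hv, hs⟩ := exists_rational_basis hΔ
  obtain ⟨w, -, hw⟩ := exists_basis_glMap g₀ hv hs rfl
  obtain ⟨b, hb, hle⟩ := exists_cov_glMap_le rfl w hw
  intro a ha
  set F : Matrix.GeneralLinearGroup (Fin m) (QS S) → ℝ := fun g => cov (glMap g₀ Δ) *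
    ∏ i, content (((g * g₀⁻¹ : Matrix.GeneralLinearGroup (Fin m) (QS S)) :
      Matrix (Fin m) (Fin m) (QS S)).mulVec (b i)) with hF
  have hFc : Continuous F := by
    refine continuous_const.mul (continuous_finsetProd _ fun i _ => continuous_content.comp ?_)
    exact (Units.continuous_val.comp (continuous_mul_const _)).matrix_mulVec continuous_const
  have hF0 : F g₀ < a := by
    refine lt_of_le_of_lt ?_ ha
    simp only [hF, mul_inv_cancel, Units.val_one, Matrix.one_mulVec]
    exact mul_le_of_le_one_right (cov_nonneg _)
      (Finset.prod_le_one (fun _ _ => content_nonneg _) fun i _ => hb i)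
  filter_upwards [hFc.continuousAt.eventually_lt_const hF0] with g hg
  refine lt_of_le_of_lt ?_ hg
  have h1 := hle (g * g₀⁻¹)
  rwa [glMap_glMap, inv_mul_cancel_right] at h1

/-- Among lattices of the same rank the larger one has the smaller covolume. -/
theorem cov_glMap_le_of_le (g : Matrix.GeneralLinearGroup (Fin m) (QS S))
    {Δ Δ' : Submodule (ZS S) (Fin m → QS S)} (h : Δ ≤ Δ') (hΔ' : Δ' ≤ stdLattice S m)
    (hspan : Submodule.span ℚ (Δ : Set (Fin m → QS S)) = Submodule.span ℚ (Δ' : Set _)) :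
    cov (glMap g Δ') ≤ cov (glMap g Δ) := by
  obtain ⟨r, v, hv, hs⟩ := exists_rational_basis (h.trans hΔ')
  obtain ⟨r', v', hv', hs'⟩ := exists_rational_basis hΔ'
  have hL : Submodule.span (QS S) (glMap g Δ' : Set (Fin m → QS S)) =
      Submodule.span (QS S) (glMap g Δ : Set (Fin m → QS S)) := by
    rw [span_QS_glMap, span_QS_glMap,
      ← Submodule.span_span_of_tower ℚ (QS S) (Δ' : Set (Fin m → QS S)), ← hspan,
      Submodule.span_span_of_tower]
  obtain ⟨w, -, hw⟩ := exists_basis_glMap g hv hs rfl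
  obtain ⟨w', -, hw'⟩ := exists_basis_glMap g hv' hs' hL
  rw [cov_eq_toReal_cellVol rfl w hw, cov_eq_toReal_cellVol hL w' hw']
  refine ENNReal.toReal_mono (cellVol_ne_top w) (cellVol_le_of_basisLattice_le ?_)
  intro x hx
  have hx1 : (x : Fin m → QS S) ∈ glMap g Δ := (SetLike.ext_iff.1 hw _).2 hx
  have hx2 : (x : Fin m → QS S) ∈ glMap g Δ' := Submodule.map_mono h hx1
  exact (SetLike.ext_iff.1 hw' _).1 hx2

/-- The smallest primitive submodule that contains a primitive submodule `Δ` and a further lattice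
vector `u` has covolume at most the covolume of `Δ` times the content of `u`. -/
theorem cov_glMap_saturation_le (g : Matrix.GeneralLinearGroup (Fin m) (QS S))
    {Δ : Submodule (ZS S) (Fin m → QS S)} (hΔ : IsPrimitiveIn Δ (stdLattice S m))
    {u : Fin m → QS S} (hu : u ∈ stdLattice S m) (huΔ : u ∉ Δ) :
    cov (glMap g (saturation (Δ ⊔ Submodule.span (ZS S) {u}))) ≤
      cov (glMap g Δ) * content ((g : Matrix (Fin m) (Fin m) (QS S)).mulVec u) := by
  have hle : Δ ⊔ Submodule.span (ZS S) {u} ≤ stdLattice S m :=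
    sup_le hΔ.1 ((Submodule.span_singleton_le_iff_mem _ _).2 hu)
  refine (cov_glMap_le_of_le g (le_saturation hle) inf_le_left (span_rat_saturation hle).symm).trans
    ?_
  obtain ⟨r, v, hv, hs⟩ := exists_rational_basis hΔ.1
  obtain ⟨u₀, -, rfl⟩ := mem_stdLattice.1 hu
  have hu₀ : u₀ ∉ Submodule.span ℚ (range v) := by
    intro h
    refine huΔ ?_
    rw [← hΔ.saturation_eq]
    refine ⟨hu, ?_⟩
    change ratVec S m u₀ ∈ Submodule.span ℚ (Δ : Set (Fin m → QS S))
    rw [span_rat_eq_map hs]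
    exact Submodule.mem_map_of_mem h
  have hv' : LinearIndependent ℚ (Fin.cons u₀ v : Fin (r + 1) → Fin m → ℚ) :=
    linearIndependent_finCons.2 ⟨hv, hu₀⟩
  have hs' : Δ ⊔ Submodule.span (ZS S) {ratVec S m u₀} = Submodule.span (ZS S)
      (range fun i => ratVec S m ((Fin.cons u₀ v : Fin (r + 1) → Fin m → ℚ) i)) := by
    have : (fun i => ratVec S m ((Fin.cons u₀ v : Fin (r + 1) → Fin m → ℚ) i)) =
        Fin.cons (ratVec S m u₀) fun i => ratVec S m (v i) := by
      funext i
      refine Fin.cases rfl (fun j => rfl) i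
    rw [this, Fin.range_cons, Submodule.span_insert, ← hs, sup_comm]
  obtain ⟨w, hwi, hw⟩ := exists_basis_glMap g hv hs rfl
  obtain ⟨w', hwi', hw'⟩ := exists_basis_glMap g hv' hs' rfl
  rw [cov_eq_toReal_cellVol rfl w hw, cov_eq_toReal_cellVol rfl w' hw']
  have h1 := cellVol_cons_le w w' fun i => by rw [hwi, hwi']; rfl
  rw [hwi'] at h1
  have h2 := ENNReal.toReal_mono (ENNReal.mul_ne_top (cellVol_ne_top w) ENNReal.ofReal_ne_top) h1
  rwa [ENNReal.toReal_mul, ENNReal.toReal_ofReal (content_nonneg _)] at h2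

theorem cov_glMap_bot_le (g : Matrix.GeneralLinearGroup (Fin m) (QS S)) :
    cov (glMap g (⊥ : Submodule (ZS S) (Fin m → QS S))) ≤ 1 := by
  obtain ⟨w, -, hw⟩ := exists_basis_glMap (L := _) g
    (linearIndependent_empty_type (v := (Fin.elim0 : Fin 0 → Fin m → ℚ)))
    (Δ := (⊥ : Submodule (ZS S) (Fin m → QS S))) (by simp) rfl
  rw [cov_eq_toReal_cellVol rfl w hw]
  refine ENNReal.toReal_le_of_le_ofReal zero_le_one ?_
  simpa using cellVol_le_prod_content w

end Inequalities

end

/-! ### From marked points to short vectors -/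

section Main

variable {S : Finset Nat.Primes} {m : ℕ}

theorem bot_isPrimitiveIn :
    IsPrimitiveIn (⊥ : Submodule (ZS S) (Fin m → QS S)) (stdLattice S m) := by
  have h : saturation (⊥ : Submodule (ZS S) (Fin m → QS S)) = ⊥ := by
    refine eq_bot_iff.2 fun x hx => ?_
    have h1 : x ∈ Submodule.span ℚ ((⊥ : Submodule (ZS S) (Fin m → QS S)) : Set (Fin m → QS S)) :=
      hx.2
    simpa using h1
  rw [← h]
  exact isPrimitiveIn_saturation bot_le

/-- At a point that is marked, all nonzero vectors of the lattice have content at least `ε`: if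
`Δ` is the largest member of the chain (or zero) that does not contain `u`, then the primitive
submodule spanned by `Δ` and `u` is comparable to all members of the chain, so its covolume is at
least `ε`. -/
theorem le_content_of_isMarked {X : Type*} {h : X → Matrix.GeneralLinearGroup (Fin m) (QS S)}
    {ε ρ : ℝ} (hρ1 : ρ ≤ 1) (hερ : ε ≤ ρ) {x : X}
    (hmark : IsMarked {Δ | IsPrimitiveIn Δ (stdLattice S m) ∧ Δ ≠ ⊥}
      (fun Δ x => cov (glMap (h x) Δ)) ε ρ x)
    {u : Fin m → QS S} (hu : u ∈ stdLattice S m) (hu0 : u ≠ 0) :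
    ε ≤ content ((h x : Matrix (Fin m) (Fin m) (QS S)).mulVec u) := by
  obtain ⟨F, hFP, hc, hF, hmax⟩ := hmark
  have hfin : F.Finite := by
    by_contra hinf
    obtain ⟨T, hTF, hT⟩ := Set.Infinite.exists_subset_card_eq hinf (m + 1)
    have := card_chain_primitive_le T (fun Δ hΔ => hFP (hTF hΔ)) (hc.mono hTF)
    omega
  obtain ⟨Δ, hΔmax⟩ := ((hfin.subset (sep_subset F fun Δ => u ∉ Δ)).insert ⊥).exists_maximal
    ⟨⊥, mem_insert _ _⟩
  have huΔ : u ∉ Δ := by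
    rcases hΔmax.prop with rfl | h1
    exacts [fun h1 => hu0 ((Submodule.mem_bot _).1 h1), h1.2]
  have hΔprim : IsPrimitiveIn Δ (stdLattice S m) := by
    rcases hΔmax.prop with rfl | h1
    exacts [bot_isPrimitiveIn, (hFP h1.1).1]
  have hΔcov : cov (glMap (h x) Δ) ≤ 1 := by
    rcases hΔmax.prop with rfl | h1
    exacts [cov_glMap_bot_le _, (hF Δ h1.1).2.trans hρ1]
  have hcompΔ : ∀ t ∈ F, Δ ≤ t ∨ t ≤ Δ := by
    intro t ht
    rcases hΔmax.prop with rfl | h1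
    exacts [Or.inl bot_le, hc.total h1.1 ht]
  have hle : Δ ⊔ Submodule.span (ZS S) {u} ≤ stdLattice S m :=
    sup_le hΔprim.1 ((Submodule.span_singleton_le_iff_mem _ _).2 hu)
  set Δ' := saturation (Δ ⊔ Submodule.span (ZS S) {u}) with hΔ'
  have hleΔ' : Δ ⊔ Submodule.span (ZS S) {u} ≤ Δ' := le_saturation hle
  have huΔ' : u ∈ Δ' := hleΔ' (Submodule.mem_sup_right (Submodule.mem_span_singleton_self u))
  have hΔ'P : IsPrimitiveIn Δ' (stdLattice S m) ∧ Δ' ≠ ⊥ := by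
    refine ⟨isPrimitiveIn_saturation hle, fun h0 => hu0 ?_⟩
    rw [h0] at huΔ'
    exact (Submodule.mem_bot _).1 huΔ'
  have hcomp : ∀ t ∈ F, Δ' ≤ t ∨ t ≤ Δ' := by
    intro t ht
    by_cases hut : u ∈ t
    · left
      have hΔt : Δ ≤ t := (hcompΔ t ht).resolve_right fun h1 => huΔ (h1 hut)
      rw [IsPrimitiveIn.le_iff_span_le hΔ'P.1.1 (hFP ht).1, span_rat_saturation hle]
      exact Submodule.span_mono (sup_le hΔt ((Submodule.span_singleton_le_iff_mem _ _).2 hut))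
    · right
      have htΔ : t ≤ Δ := by
        rcases hcompΔ t ht with h1 | h1
        exacts [hΔmax.le_of_ge (mem_insert_of_mem _ ⟨ht, hut⟩) h1, h1]
      exact htΔ.trans (le_sup_left.trans hleΔ')
  have hεΔ' : ε ≤ cov (glMap (h x) Δ') := by
    by_cases hmem : Δ' ∈ F
    exacts [(hF Δ' hmem).1, hερ.trans (hmax Δ' hΔ'P hmem hcomp)]
  calc ε ≤ cov (glMap (h x) Δ') := hεΔ'
    _ ≤ cov (glMap (h x) Δ) * content ((h x : Matrix (Fin m) (Fin m) (QS S)).mulVec u) :=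
        cov_glMap_saturation_le _ hΔprim hu huΔ
    _ ≤ content ((h x : Matrix (Fin m) (Fin m) (QS S)).mulVec u) :=
        mul_le_of_le_one_left (content_nonneg _) hΔcov

/-- A lower bound for the contents of the nonzero lattice vectors bounds `δ` from below. The
assumption `0 < m` provides such vectors. -/
theorem le_delta_glMap (hm : 0 < m) (g : Matrix.GeneralLinearGroup (Fin m) (QS S)) {ε : ℝ}
    (h : ∀ u ∈ stdLattice S m, u ≠ 0 → ε ≤ content ((g : Matrix (Fin m) (Fin m) (QS S)).mulVec u)) :
    ε ≤ delta (glMap g (stdLattice S m)) := by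
  have hg := mulVecLin_injective g
  refine le_csInf (Set.Nonempty.image _ ?_) ?_
  · set u : Fin m → QS S := ratVec S m (fun _ => 1) with hu
    have hu0 : u ≠ 0 := by
      intro h0
      have h1 := congrFun (ratVec_injective (h0.trans (map_zero (ratVec S m)).symm)) ⟨0, hm⟩
      exact one_ne_zero h1
    have humem : u ∈ stdLattice S m := mem_stdLattice.2 ⟨_, fun _ => (ZS S).one_mem, rfl⟩
    exact ⟨_, ⟨u, humem, rfl⟩, fun h0 => hu0 ((map_eq_zero_iff _ hg).1 h0)⟩
  · rintro _ ⟨_, ⟨⟨u, hu, rfl⟩, hy0⟩, rfl⟩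
    refine h u hu ?_
    rintro rfl
    exact hy0 (map_zero _)

end Main

end

theorem theorem8p3 {X : Type*} [MetricSpace X] [MeasurableSpace X] [BorelSpace X]
    (hX : IsBesicovitch X) (μ : Measure X) (hμ : IsUniformlyFederer μ)
    (S : Finset Nat.Primes) (m : ℕ) (hm : 0 < m)
    (x₀ : X) (r₀ : ℝ) (hx₀ : x₀ ∈ μ.support) (hr₀ : 0 < r₀)
    (h : X → Matrix.GeneralLinearGroup (Fin m) (QS S))
    (hh : ContinuousOn h (Metric.ball x₀ (3 ^ m * r₀)))
    (C α ρ : ℝ) (hC : 0 < C) (hα : 0 < α) (hρ : 0 < ρ) (hρ1 : ρ < 1)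
    (hgood : ∀ Δ : Submodule (ZS S) (Fin m → QS S), IsPrimitiveIn Δ (stdLattice S m) → Δ ≠ ⊥ →
      IsGood C α μ (fun x => cov (glMap (h x) Δ)) (Metric.ball x₀ (3 ^ m * r₀)))
    (hsup : ∀ Δ : Submodule (ZS S) (Fin m → QS S), IsPrimitiveIn Δ (stdLattice S m) → Δ ≠ ⊥ →
      ENNReal.ofReal ρ ≤ supNormOn μ (fun x => cov (glMap (h x) Δ)) (Metric.ball x₀ r₀))
    (ε : ℝ) (hε : 0 < ε) (hερ : ε ≤ ρ) :
    μ {x ∈ Metric.ball x₀ r₀ | delta (glMap (h x) (stdLattice S m)) < ε} ≤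
      ENNReal.ofReal (m * C) * ((besicovitchConst X : ℝ≥0∞) * federerConst μ 3 ^ 2) ^ m *
        ENNReal.ofReal ((ε / ρ) ^ α) * μ (Metric.ball x₀ r₀) := by
  have hN : HasCoveringMultiplicity X (besicovitchConst X) := Nat.sInf_mem hX
  set P : Set (Submodule (ZS S) (Fin m → QS S)) :=
    {Δ | IsPrimitiveIn Δ (stdLattice S m) ∧ Δ ≠ ⊥} with hP
  have hmain := measure_not_isMarked_le hN hμ
    (ψ := fun (Δ : Submodule (ZS S) (Fin m → QS S)) x => cov (glMap (h x) Δ))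
    (fun Δ x => cov_nonneg _) (C := C) hα hε hρ m P x₀ r₀ hx₀ hr₀
    (fun F hF hc => card_chain_primitive_le F hF hc) (fun Δ hΔ => hgood Δ hΔ.1 hΔ.2)
    (fun Δ hΔ y hy a ha => (hh.continuousAt (Metric.isOpen_ball.mem_nhds hy)).eventually
      (upperSemicontinuousAt_cov_glMap hΔ.1.1 (h y) a ha))
    fun Δ hΔ => hsup Δ hΔ.1 hΔ.2
  have hsub : {x ∈ Metric.ball x₀ r₀ | delta (glMap (h x) (stdLattice S m)) < ε} ⊆
      {x ∈ Metric.ball x₀ r₀ | x ∈ μ.support ∧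
        ¬ IsMarked P (fun Δ x => cov (glMap (h x) Δ)) ε ρ x} ∪ μ.supportᶜ := by
    rintro x ⟨hx, hδ⟩
    by_cases hxs : x ∈ μ.support
    · refine Or.inl ⟨hx, hxs, fun hmark => absurd hδ (not_lt.2 ?_)⟩
      exact le_delta_glMap hm (h x) fun u hu hu0 => le_content_of_isMarked hρ1.le hερ hmark hu hu0
    · exact Or.inr hxs
  refine (measure_mono hsub).trans ((measure_union_le _ _).trans ?_)
  rw [hN.measure_compl_support μ, add_zero]
  refine hmain.trans (le_of_eq ?_)
  rw [ENNReal.ofReal_mul (Nat.cast_nonneg m), ENNReal.ofReal_natCast,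
    ← ENNReal.ofReal_rpow_of_pos (div_pos hε hρ), ENNReal.ofReal_div_of_pos hρ]
  ring
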